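/- Let $T>0$, $N\in\mathbb N_+$, $\lambda\in\{1,-1\}$, $H=L^2((0,1);\mathbb R)$, $\mathbb H=L^2((0,1);\mathbb C)$ with norm $\|\cdot\|$, and let $u_0\in\mathbb H$. Let $\mathbb H_N\subset\mathbb H$ be the complex span of the first $N$ eigenfunctions $\sqrt2\sin(k\pi x)$, $k=1,\dots,N$, of the Dirichlet Laplacian $\Delta$ on $(0,1)$, let $P^N:\mathbb H\to\mathbb H_N$ be the orthogonal projection, $S^N(t)=P^Ne^{\mathbf i t\Delta}$, $\lambda_N=N^2\pi^2$, and $\mathcal H(u)=\frac12\|\nabla u\|^2-\frac\lambda4\|u\|_{L^4}^4$. Let $Q^{1/2}$ be a bounded nonnegative self-adjoint operator on $H$, let $H_0=Q^{1/2}H$ with $\|v\|_{H_0}=\|Q^{-1/2}v\|_H$ ($Q^{-1/2}$ the pseudo-inverse), and for $M>0$ let $\mathcal S_M=\{\nu\in L^2([0,T];H_0):\int_0^T\|\nu(s)\|_{H_0}^2\,ds\le M\}$. Let $(\tau_m)_{m\ge0}$ be positive time steps, the same for all controls, and let $t_0=0$, $t_{m+1}=\min\{t_m+\tau_m,T\}$;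 the steps of the scheme are those with $t_m<T$. For $\nu\in L^2([0,T];H_0)$ the skeleton equation is: $w_{\nu,0}=P^Nu_0$ and, on $[t_m,t_{m+1}]$, $$\frac{d}{dt}w^{D}_{\nu,m}(t)=\mathbf i\Delta w^{D}_{\nu,m}(t)+\mathbf i\lambda S^N(t-t_m)P^N\big(|w_{\nu,m}|^2w_{\nu,m}\big),\qquad w^{D}_{\nu,m}(t_m)=w_{\nu,m},$$ $$w^{S}_{\nu,m}(t)=w^{D}_{\nu,m}(t_{m+1})-\mathbf i\int_{t_m}^tP^N\big(w^{S}_{\nu,m}(s)\nu(s)\big)\,ds,\qquad w_{\nu,m+1}=w^{S}_{\nu,m}(t_{m+1}).$$ Its solution is the path $w_\nu:[0,T]\to\mathbb H_N$ with $w_\nu(t)=w^S_{\nu,m}(t)$ for $t\in[t_m,t_{m+1})$, and with $w_\nu(T)=w^S_{\nu,m}(T)$ for the last step $m$. Put $\mathcal G^0\big(\int_0^\cdot\nu(s)\,ds\big)=w_\nu$. Fix $M>0$ and suppose that there are constants $L_1,\zeta,\beta,\xi,L_2,L_3>0$, $\delta\in(0,1)$ and $\gamma\in(0,\frac12)$ such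 that for all $\nu\in\mathcal S_M$ and all $m$ with $t_m<T$ $$\tau_m\le\min\big\{L_1\|w_{\nu,m}\|^2\|w_{\nu,m}\|_{L^6}^{-6},\,T\delta\big\},\qquad \tau_m\ge(\zeta\|w_{\nu,m}\|^\beta+\xi)^{-1}\delta,$$ $$\tau_m^{\frac12-\gamma}\lambda_N\le L_2,\qquad \tau_m^\gamma\,\mathcal H(w_{\nu,m})\le L_3$$ (the bound with $L_1$ is void if $w_{\nu,m}=0$). Then for each $\nu\in\mathcal S_M$ the skeleton equation has exactly one solution, it is $\mathcal G^0\big(\int_0^\cdot\nu(s)\,ds\big)$, it is continuous on each $[t_m,t_{m+1})$ with a limit at $t_{m+1}$ and left-continuous at $T$, and the set $$K_M=\Big\{\mathcal G^0\Big(\int_0^\cdot\nu(s)\,ds\Big):\nu\in\mathcal S_M\Big\}$$ is compact with respect to uniform convergence on $[0,T]$, i.e. for the norm $\sup_{t\in[0,T]}\|w(t)\|$. -/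

import Mathlib

open MeasureTheory Set Filter Topology
open scoped ENNReal InnerProductSpace UniformConvergence

noncomputable section

namespace SkeletonNLS

/-! ### The function spaces on the domain `(0,1)` -/

/-- Lebesgue measure on the domain `(0,1)`. -/
abbrev dom : Measure ℝ := volume.restrict (Ioo (0 : ℝ) 1)

/-- `L²((0,1); ℝ)`. -/
abbrev RealL2 : Type := Lp ℝ 2 dom

/-- `L²((0,1); ℂ)`. -/
abbrev CplxL2 : Type := Lp ℂ 2 dom

/-- The normalised eigenfunction `√2 sin(k π x)` of the Dirichlet Laplacian on `(0,1)`. -/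
def sine (k : ℕ) (x : ℝ) : ℝ := Real.sqrt 2 * Real.sin (k * Real.pi * x)

/-- The corresponding eigenvalue `k² π²` of the negative Dirichlet Laplacian. -/
def eigval (k : ℕ) : ℝ := (k : ℝ) ^ 2 * Real.pi ^ 2

theorem sine_memLp (k : ℕ) : MemLp (fun x => (sine k x : ℂ)) 2 dom := by
  refine MemLp.of_bound (C := Real.sqrt 2) ?_ ?_
  · apply Continuous.aestronglyMeasurable
    unfold sine
    fun_prop
  · refine Eventually.of_forall fun x => ?_
    rw [Complex.norm_real, sine, norm_mul, Real.norm_eq_abs, Real.norm_eq_abs,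
      abs_of_nonneg (Real.sqrt_nonneg 2)]
    exact mul_le_of_le_one_right (Real.sqrt_nonneg 2) (Real.abs_sin_le_one _)

/-- The `k`-th eigenfunction as an element of `L²((0,1); ℂ)`. -/
def mode (k : ℕ) : CplxL2 := (sine_memLp k).toLp _

/-- The Galerkin space `H_N`: the complex span of the eigenfunctions with numbers `1, …, N`,
with the norm of `L²((0,1); ℂ)`. -/
def GalerkinSubmodule (N : ℕ) : Submodule ℂ CplxL2 :=
  Submodule.span ℂ (range fun k : Fin N => mode (k + 1))

/-- The Galerkin space `H_N` as a type. -/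
abbrev Galerkin (N : ℕ) : Type := GalerkinSubmodule N

instance (N : ℕ) : FiniteDimensional ℂ (GalerkinSubmodule N) :=
  FiniteDimensional.span_of_finite ℂ (finite_range _)

/-- The spectral Galerkin projection `P^N`. -/
def proj (N : ℕ) : CplxL2 →L[ℂ] Galerkin N := (GalerkinSubmodule N).orthogonalProjectionOnto

theorem galerkin_bound {N : ℕ} (u : Galerkin N) :
    ∃ C : ℝ, ∀ᵐ x ∂dom, ‖(u : CplxL2) x‖ ≤ C := by
  obtain ⟨u, hu⟩ := u
  induction hu using Submodule.span_induction with
  | mem v hv =>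
    obtain ⟨k, rfl⟩ := hv
    refine ⟨Real.sqrt 2, ?_⟩
    filter_upwards [(sine_memLp (k + 1)).coeFn_toLp] with x hx
    change ‖((sine_memLp (k + 1)).toLp _ : CplxL2) x‖ ≤ _
    rw [hx, Complex.norm_real, sine, norm_mul, Real.norm_eq_abs, Real.norm_eq_abs,
      abs_of_nonneg (Real.sqrt_nonneg 2)]
    exact mul_le_of_le_one_right (Real.sqrt_nonneg 2) (Real.abs_sin_le_one _)
  | zero =>
    refine ⟨0, ?_⟩
    filter_upwards [Lp.coeFn_zero ℂ 2 dom] with x hx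
    change ‖(0 : CplxL2) x‖ ≤ 0
    rw [hx, Pi.zero_apply, norm_zero]
  | add v w _ _ hv hw =>
    obtain ⟨C, hC⟩ := hv
    obtain ⟨D, hD⟩ := hw
    refine ⟨C + D, ?_⟩
    filter_upwards [hC, hD, Lp.coeFn_add v w] with x h1 h2 h3
    change ‖(v + w : CplxL2) x‖ ≤ _
    rw [h3]
    exact (norm_add_le _ _).trans (add_le_add h1 h2)
  | smul a v _ hv =>
    obtain ⟨C, hC⟩ := hv
    refine ⟨‖a‖ * C, ?_⟩
    filter_upwards [hC, Lp.coeFn_smul a v] with x h1 h2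
    change ‖(a • v : CplxL2) x‖ ≤ _
    rw [h2, Pi.smul_apply, norm_smul]
    exact mul_le_mul_of_nonneg_left h1 (norm_nonneg _)

theorem cubic_memLp {N : ℕ} (u : Galerkin N) :
    MemLp (fun x => ((‖(u : CplxL2) x‖ ^ 2 : ℝ) : ℂ) * (u : CplxL2) x) 2 dom := by
  obtain ⟨C, hC⟩ := galerkin_bound u
  have hm := Lp.aestronglyMeasurable (u : CplxL2)
  refine MemLp.of_bound (C := C ^ 2 * C) ?_ ?_
  · exact (Complex.continuous_ofReal.comp_aestronglyMeasurable (hm.norm.pow 2)).mul hm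
  · filter_upwards [hC] with x hx
    rw [norm_mul, Complex.norm_real, norm_pow, norm_norm]
    exact mul_le_mul (pow_le_pow_left₀ (norm_nonneg _) hx 2) hx (norm_nonneg _) (sq_nonneg _)

/-- The nonlinearity `|u|² u` of an element of `H_N`. -/
def cubic {N : ℕ} (u : Galerkin N) : CplxL2 := (cubic_memLp u).toLp _

theorem pot_memLp {N : ℕ} (u : Galerkin N) (v : RealL2) :
    MemLp (fun x => (u : CplxL2) x * ((v x : ℝ) : ℂ)) 2 dom := by
  obtain ⟨C, hC⟩ := galerkin_bound u
  have hm := Lp.aestronglyMeasurable (u : CplxL2)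
  have hv := Lp.aestronglyMeasurable v
  refine (Lp.memLp v).of_le_mul (c := C) ?_ ?_
  · exact hm.mul (Complex.continuous_ofReal.comp_aestronglyMeasurable hv)
  · filter_upwards [hC] with x hx
    rw [norm_mul, Complex.norm_real]
    exact mul_le_mul_of_nonneg_right hx (norm_nonneg _)

/-- The pointwise product `u v` of `u ∈ H_N` with a real-valued `v ∈ L²((0,1); ℝ)`. -/
def pot {N : ℕ} (u : Galerkin N) (v : RealL2) : CplxL2 := (pot_memLp u v).toLp _

/-- The `k`-th eigenfunction as an element of `H_N`, for `k = 1, …, N` (numbered from `0`). -/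
def gmode {N : ℕ} (k : Fin N) : Galerkin N := ⟨mode (k + 1), Submodule.subset_span ⟨k, rfl⟩⟩

/-- The Dirichlet Laplacian on `H_N`. -/
def lap {N : ℕ} (u : Galerkin N) : Galerkin N :=
  ∑ k : Fin N, (-(eigval (k + 1) : ℂ) * ⟪gmode k, u⟫_ℂ) • gmode k

/-- `S^N(t) = P^N exp(i t Δ)`, restricted to `H_N`. -/
def semigroup {N : ℕ} (t : ℝ) (u : Galerkin N) : Galerkin N :=
  ∑ k : Fin N, (Complex.exp (-(Complex.I * t * eigval (k + 1))) * ⟪gmode k, u⟫_ℂ) • gmode k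

/-- The smooth representative of `u ∈ H_N`. -/
def rep {N : ℕ} (u : Galerkin N) (x : ℝ) : ℂ :=
  ∑ k : Fin N, ⟪gmode k, u⟫_ℂ * (sine (k + 1) x : ℂ)

/-- The Hamiltonian `½ ‖∇u‖² - (lam / 4) ‖u‖⁴_{L⁴}` on `H_N`. -/
def hamiltonian {N : ℕ} (lam : ℝ) (u : Galerkin N) : ℝ :=
  (1 / 2) * (∫ x, ‖deriv (rep u) x‖ ^ 2 ∂dom) - (lam / 4) * ∫ x, ‖(u : CplxL2) x‖ ^ 4 ∂dom

/-! ### The space `H₀ = Q^{1/2} L²((0,1); ℝ)` and the controls -/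

/-- The range of `R` (the operator `Q^{1/2}`), as a type of its own because its norm is not the
one of `L²`. -/
def CamSpace (R : RealL2 →L[ℝ] RealL2) : Type := LinearMap.range (R : RealL2 →ₗ[ℝ] RealL2)

instance (R : RealL2 →L[ℝ] RealL2) : AddCommGroup (CamSpace R) :=
  inferInstanceAs (AddCommGroup (LinearMap.range (R : RealL2 →ₗ[ℝ] RealL2)))

instance (R : RealL2 →L[ℝ] RealL2) : Module ℝ (CamSpace R) :=
  inferInstanceAs (Module ℝ (LinearMap.range (R : RealL2 →ₗ[ℝ] RealL2)))

/-- The inclusion of `H₀` into `L²((0,1); ℝ)`. -/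
def CamSpace.incl (R : RealL2 →L[ℝ] RealL2) : CamSpace R →ₗ[ℝ] RealL2 :=
  (LinearMap.range (R : RealL2 →ₗ[ℝ] RealL2)).subtype

/-- `R` restricted to the orthogonal complement of its kernel, with values in its range. -/
def CamSpace.restr (R : RealL2 →L[ℝ] RealL2) :
    (LinearMap.ker (R : RealL2 →ₗ[ℝ] RealL2))ᗮ →ₗ[ℝ] CamSpace R :=
  (R : RealL2 →ₗ[ℝ] RealL2).rangeRestrict ∘ₗ
    ((LinearMap.ker (R : RealL2 →ₗ[ℝ] RealL2))ᗮ).subtype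

theorem CamSpace.restr_bijective (R : RealL2 →L[ℝ] RealL2) :
    Function.Bijective (CamSpace.restr R) := by
  constructor
  · rw [injective_iff_map_eq_zero]
    rintro ⟨x, hx⟩ h
    have h1 : R x = 0 := congrArg (CamSpace.incl R) h
    have h2 : x ∈ LinearMap.ker (R : RealL2 →ₗ[ℝ] RealL2) := h1
    have h3 : ⟪x, x⟫_ℝ = 0 := hx x h2
    exact Subtype.ext (inner_self_eq_zero.mp h3)
  · rintro ⟨y, x, rfl⟩
    have hc : IsClosed (LinearMap.ker (R : RealL2 →ₗ[ℝ] RealL2) : Set RealL2) :=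
      ContinuousLinearMap.isClosed_ker R
    have : CompleteSpace (LinearMap.ker (R : RealL2 →ₗ[ℝ] RealL2)) := hc.completeSpace_coe
    obtain ⟨a, ha, b, hb, hab⟩ :=
      (LinearMap.ker (R : RealL2 →ₗ[ℝ] RealL2)).exists_add_mem_mem_orthogonal x
    refine ⟨⟨b, hb⟩, Subtype.ext ?_⟩
    change R b = R x
    have ha' : R a = 0 := ha
    rw [hab, map_add, ha', zero_add]

/-- The pseudo-inverse `R⁻¹ : H₀ → (ker R)ᗮ`: it maps `v` to the preimage of `v` of minimal
norm. -/
def CamSpace.pinv (R : RealL2 →L[ℝ] RealL2) :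
    CamSpace R ≃ₗ[ℝ] (LinearMap.ker (R : RealL2 →ₗ[ℝ] RealL2))ᗮ :=
  (LinearEquiv.ofBijective (CamSpace.restr R) (CamSpace.restr_bijective R)).symm

/-- The norm of `H₀` is `‖v‖_{H₀} = ‖R⁻¹ v‖`. -/
instance (R : RealL2 →L[ℝ] RealL2) : NormedAddCommGroup (CamSpace R) :=
  NormedAddCommGroup.induced _ _ (CamSpace.pinv R) (CamSpace.pinv R).injective

/-- The inner product of `H₀` is `⟪u, v⟫_{H₀} = ⟪R⁻¹ u, R⁻¹ v⟫`. -/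
instance (R : RealL2 →L[ℝ] RealL2) : InnerProductSpace ℝ (CamSpace R) :=
  InnerProductSpace.induced (CamSpace.pinv R)

/-- `L²([0,T]; H₀)`. -/
abbrev Control (R : RealL2 →L[ℝ] RealL2) (T : ℝ) : Type :=
  Lp (CamSpace R) 2 (volume.restrict (Icc (0 : ℝ) T))

/-- The set `S_M` of the controls `ν ∈ L²([0,T]; H₀)` with `∫₀ᵀ ‖ν(s)‖²_{H₀} ds ≤ M`. -/
def controlBall (R : RealL2 →L[ℝ] RealL2) (T M : ℝ) : Set (Control R T) :=
  {ν | ∫ s in Icc (0 : ℝ) T, ‖ν s‖ ^ 2 ≤ M}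

theorem CamSpace.norm_incl_le (R : RealL2 →L[ℝ] RealL2) (v : CamSpace R) :
    ‖CamSpace.incl R v‖ ≤ ‖R‖ * ‖v‖ := by
  have h : CamSpace.restr R (CamSpace.pinv R v) = v :=
    (LinearEquiv.ofBijective (CamSpace.restr R) (CamSpace.restr_bijective R)).apply_symm_apply v
  have h2 : CamSpace.incl R v = R (CamSpace.pinv R v : RealL2) := by
    conv_lhs => rw [← h]
    rfl
  rw [h2]
  exact R.le_opNorm _

theorem control_integrable {R : RealL2 →L[ℝ] RealL2} {T : ℝ} (ν : Control R T) :
    IntegrableOn (fun s => CamSpace.incl R (ν s)) (Icc 0 T) := by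
  have h1 : Integrable ν (volume.restrict (Icc (0 : ℝ) T)) :=
    (Lp.memLp ν).integrable (by norm_num)
  exact ((CamSpace.incl R).mkContinuous ‖R‖ (CamSpace.norm_incl_le R)).integrable_comp h1

/-- The path `∫₀^· ν(s) ds`, an element of `C([0,T]; L²((0,1); ℝ))`. -/
def primitive {R : RealL2 →L[ℝ] RealL2} {T : ℝ} (ν : Control R T) :
    C(Icc (0 : ℝ) T, RealL2) where
  toFun t := ∫ s in (0 : ℝ)..t, CamSpace.incl R (ν s)
  continuous_toFun := by
    by_cases hT : 0 ≤ T
    · have h : IntegrableOn (fun s => CamSpace.incl R (ν s)) (uIcc 0 T) volume :=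
        (control_integrable ν).mono_set (uIcc_of_le hT).subset
      have h2 := intervalIntegral.continuousOn_primitive_interval h
      rw [uIcc_of_le hT] at h2
      exact h2.domRestrict
    · have : IsEmpty (Icc (0 : ℝ) T) := ⟨fun t => hT (t.2.1.trans t.2.2)⟩
      exact continuous_of_discreteTopology

/-! ### The time grid and the skeleton equation -/

/-- The grid `t_0 = 0`, `t_{m+1} = t_m + τ_m`, where the last step is shortened so that the grid
ends in `T`. The steps of the scheme are those with `t_m < T`. -/
def grid (T : ℝ) (τ : ℕ → ℝ) : ℕ → ℝ
  | 0 => 0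
  | m + 1 => min (grid T τ m + τ m) T

/-- `t ∈ T_m = [t_m, t_{m+1})`; the final time `T` is assigned to the last step. -/
def InCell (T : ℝ) (τ : ℕ → ℝ) (m : ℕ) (t : ℝ) : Prop :=
  grid T τ m ≤ t ∧
    (t < grid T τ (m + 1) ∨ (t = T ∧ grid T τ m < T ∧ grid T τ (m + 1) = T))

/-- The split skeleton equation with control `ν`: `wN m` is the value `w_m`, `wD m` and `wS m` are
the solutions of the two subequations on the `m`-th time interval. The second subequation, whose
right-hand side is only integrable in time, is understood in the integrated sense. -/
structure IsScheme {N : ℕ} {R : RealL2 →L[ℝ] RealL2} {T : ℝ} (lam : ℝ) (τ : ℕ → ℝ)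
    (u₀ : CplxL2) (ν : Control R T) (wN : ℕ → Galerkin N) (wD wS : ℕ → ℝ → Galerkin N) :
    Prop where
  init : wN 0 = proj N u₀
  det_init : ∀ m, wD m (grid T τ m) = wN m
  det_eq : ∀ m, ∀ t ∈ Icc (grid T τ m) (grid T τ (m + 1)),
    HasDerivWithinAt (wD m)
      (Complex.I • lap (wD m t)
        + (Complex.I * (lam : ℂ)) • semigroup (t - grid T τ m) (proj N (cubic (wN m))))
      (Icc (grid T τ m) (grid T τ (m + 1))) t
  con_cont : ∀ m, ContinuousOn (wS m) (Icc (grid T τ m) (grid T τ (m + 1)))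
  con_eq : ∀ m, ∀ t ∈ Icc (grid T τ m) (grid T τ (m + 1)),
    wS m t = wD m (grid T τ (m + 1))
      + ∫ s in (grid T τ m)..t, -Complex.I • proj N (pot (wS m s) (CamSpace.incl R (ν s)))
  next : ∀ m, wN (m + 1) = wS m (grid T τ (m + 1))

/-- `w` is the path `t ↦ w^S_m(t)`, `t ∈ T_m`, of the skeleton equation with control `ν`. The
topology of the space `Icc 0 T →ᵤ Galerkin N` of functions is that of uniform convergence. -/
def IsSkeletonSolution {N : ℕ} {R : RealL2 →L[ℝ] RealL2} {T : ℝ} (lam : ℝ) (τ : ℕ → ℝ)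
    (u₀ : CplxL2) (ν : Control R T) (w : Icc (0 : ℝ) T →ᵤ Galerkin N) : Prop :=
  ∃ wN wD wS, IsScheme lam τ u₀ ν wN wD wS ∧
    ∀ (m : ℕ) (t : Icc (0 : ℝ) T), InCell T τ m t → UniformFun.toFun w t = wS m t

open Classical in
/-- The map `G⁰` with `G⁰(∫₀^· ν(s) ds) = w_ν`; it is `0` at paths which are not of the form
`∫₀^· ν(s) ds` with `ν ∈ L²([0,T]; H₀)`. -/
def skeletonMap (N : ℕ) (R : RealL2 →L[ℝ] RealL2) (T lam : ℝ) (τ : ℕ → ℝ) (u₀ : CplxL2)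
    (f : C(Icc (0 : ℝ) T, RealL2)) : Icc (0 : ℝ) T →ᵤ Galerkin N :=
  if h : ∃ (w : Icc (0 : ℝ) T →ᵤ Galerkin N) (ν : Control R T),
      primitive ν = f ∧ IsSkeletonSolution lam τ u₀ ν w
  then h.choose else UniformFun.ofFun fun _ => 0

/-- The set `K_M`. -/
def skeletonSet (N : ℕ) (R : RealL2 →L[ℝ] RealL2) (T lam : ℝ) (τ : ℕ → ℝ) (u₀ : CplxL2)
    (M : ℝ) : Set (Icc (0 : ℝ) T →ᵤ Galerkin N) :=
  (fun ν : Control R T => skeletonMap N R T lam τ u₀ (primitive ν)) '' controlBall R T M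

/-- The paths which are continuous on each `T_m` and have a limit at its right end point; a path
of this kind is also left-continuous at `T`. -/
def piecewiseCont (N : ℕ) (T : ℝ) (τ : ℕ → ℝ) : Set (Icc (0 : ℝ) T →ᵤ Galerkin N) :=
  {w | ∀ m, grid T τ m < T → ∃ g : ℝ → Galerkin N,
    ContinuousOn g (Icc (grid T τ m) (grid T τ (m + 1))) ∧
      ∀ t : Icc (0 : ℝ) T, InCell T τ m t → UniformFun.toFun w t = g t}

/-! ### The assumptions on the time steps -/

/-- The bounds on the time steps along the skeleton equations with controls in `S_M`. The first
one is `τ_m ≤ L₁ ‖w_m‖² ‖w_m‖_{L⁶}⁻⁶`, without a restriction if `w_m = 0` (`1/0 = ∞`). -/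
def StepBounds (N : ℕ) (R : RealL2 →L[ℝ] RealL2) (T lam : ℝ) (τ : ℕ → ℝ) (u₀ : CplxL2)
    (M L₁ ζ β ξ δ : ℝ) : Prop :=
  ∀ ν ∈ controlBall R T M, ∀ (wN : ℕ → Galerkin N) (wD wS : ℕ → ℝ → Galerkin N),
    IsScheme lam τ u₀ ν wN wD wS → ∀ m, grid T τ m < T →
      τ m * (∫ x, ‖(wN m : CplxL2) x‖ ^ 6 ∂dom) ≤ L₁ * ‖wN m‖ ^ 2 ∧
      τ m ≤ T * δ ∧
      (ζ * ‖wN m‖ ^ β + ξ)⁻¹ * δ ≤ τ m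

/-- The further bounds on the time steps along the skeleton equations with controls in `S_M`, with
the `N`-th eigenvalue `λ_N = N² π²` and the Hamiltonian. -/
def StepBoundsEnergy (N : ℕ) (R : RealL2 →L[ℝ] RealL2) (T lam : ℝ) (τ : ℕ → ℝ) (u₀ : CplxL2)
    (M γ L₂ L₃ : ℝ) : Prop :=
  ∀ ν ∈ controlBall R T M, ∀ (wN : ℕ → Galerkin N) (wD wS : ℕ → ℝ → Galerkin N),
    IsScheme lam τ u₀ ν wN wD wS → ∀ m, grid T τ m < T →
      τ m ^ (1 / 2 - γ) * eigval N ≤ L₂ ∧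
      τ m ^ γ * hamiltonian lam (wN m) ≤ L₃

end SkeletonNLS

end

namespace SkeletonNLS

/-! The set is the image of a ball of the Hilbert space of controls. Such a ball is weakly compact
(Banach–Alaoglu and Riesz), so it suffices that the solution depends continuously on the control,
from the weak topology of the ball to uniform convergence (`IsSkeletonSolution.tendsto`,
`isCompact_image_of_tendsto_of_weak`). Convergence is along arbitrary filters, so no metrizability
of the weak topology is needed.

On one cell the deterministic part is explicit (`detStep`) and continuous in `w_m`, and the
controlled part is a linear Volterra equation `u(t) = x + ∫ B(ν) u`, with `B` bounded because sup
norm and `L²` norm are comparable on `H_N`. Picard iteration solves it and Grönwall gives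
uniqueness. The same Grönwall argument bounds the difference of two solutions by the perturbation `∫
B(ν - ν₀) u₀` along the fixed limit `u₀`. Under weak convergence this tends to zero pointwise in
time, since `H_N` is finite-dimensional, and then uniformly, since the integrals are equi-Hölder
(`tendstoUniformlyOn_integral_bilin`). Induction passes this through the cells
(`tendstoUniformlyOn_scheme`).

Finitely many cells suffice: along the zero control the step bounds give an exponential bound for
the norms, hence a positive lower bound for the steps, and the grid reaches `T` (`exists_grid_eq`).
The map on paths is well defined because a control is determined by its primitive
(`primitive_injective`). -/

/-! ### Grönwall's inequality in integral form -/

/-- The majorant `G(t) = ε + C ∫ z` has right derivative `C z ≤ C G`, so the differential form of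
Grönwall applies to `G`. -/
theorem le_mul_exp_of_le_integral {z : ℝ → ℝ} {a b C ε : ℝ} (hz : ContinuousOn z (Icc a b))
    (hC : 0 ≤ C) (hz0 : ∀ t ∈ Icc a b, 0 ≤ z t)
    (h : ∀ t ∈ Icc a b, z t ≤ ε + C * ∫ s in a..t, z s) :
    ∀ t ∈ Icc a b, z t ≤ ε * Real.exp (C * (t - a)) := by
  intro t ht
  have hab : a ≤ b := ht.1.trans ht.2
  have hε : 0 ≤ ε := by
    have h1 := h a ⟨le_rfl, hab⟩
    have h2 := hz0 a ⟨le_rfl, hab⟩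
    simp only [intervalIntegral.integral_same, mul_zero, add_zero] at h1
    exact h2.trans h1
  have hint : IntegrableOn z (Icc a b) := hz.integrableOn_Icc
  have hcont : ContinuousOn (fun t => ε + C * ∫ s in a..t, z s) (Icc a b) := by
    have := intervalIntegral.continuousOn_primitive_interval
      (f := z) (μ := volume) (a := a) (b := b) (by rwa [uIcc_of_le hab])
    rw [uIcc_of_le hab] at this
    exact continuousOn_const.add (continuousOn_const.mul this)
  have hderiv : ∀ x ∈ Ico a b,
      HasDerivWithinAt (fun t => ε + C * ∫ s in a..t, z s) (C * z x) (Ici x) x := by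
    intro x hx
    have hle : 𝓝[>] x ≤ 𝓝[Icc a b] x := by
      rw [← nhdsWithin_Ioc_eq_nhdsGT hx.2]
      exact nhdsWithin_mono _ fun y hy => ⟨hx.1.trans hy.1.le, hy.2⟩
    have hii : IntervalIntegrable z volume a x := by
      rw [intervalIntegrable_iff_integrableOn_Icc_of_le hx.1]
      exact hint.mono_set (Icc_subset_Icc le_rfl hx.2.le)
    have hm : StronglyMeasurableAtFilter z (𝓝[>] x) volume :=
      (hz.stronglyMeasurableAtFilter_nhdsWithin measurableSet_Icc x).filter_mono hle
    have hc : ContinuousWithinAt z (Ioi x) x := (hz x ⟨hx.1, hx.2.le⟩).mono_left hle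
    exact ((intervalIntegral.integral_hasDerivWithinAt_right hii hm hc).const_mul C).const_add ε
  have hnn : ∀ x ∈ Icc a b, 0 ≤ ε + C * ∫ s in a..x, z s := fun x hx =>
    (hz0 x hx).trans (h x hx)
  have key := norm_le_gronwallBound_of_norm_deriv_right_le (δ := ε) (K := C) (ε := 0)
    hcont hderiv (by simp [abs_of_nonneg hε]) (by
      intro x hx
      have hx' : x ∈ Icc a b := ⟨hx.1, hx.2.le⟩
      rw [add_zero, norm_mul, Real.norm_of_nonneg hC, Real.norm_of_nonneg (hz0 x hx'),
        Real.norm_of_nonneg (hnn x hx')]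
      exact mul_le_mul_of_nonneg_left (h x hx') hC) t ht
  rw [gronwallBound_ε0, Real.norm_of_nonneg (hnn t ht)] at key
  exact (h t ht).trans key

/-! ### Linear Volterra equations with a square-integrable kernel -/

section Volterra

variable {E F : Type*} [NormedAddCommGroup E] [NormedSpace ℝ E]
  [NormedAddCommGroup F] [InnerProductSpace ℝ F] {T : ℝ}

theorem integral_sq_norm_eq (ν : Lp F 2 (volume.restrict (Icc (0 : ℝ) T))) :
    ∫ s in Icc (0 : ℝ) T, ‖ν s‖ ^ 2 = ‖ν‖ ^ 2 := by
  rw [← real_inner_self_eq_norm_sq, L2.inner_def]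
  simp_rw [real_inner_self_eq_norm_sq]

variable (B : F →L[ℝ] E →L[ℝ] E) (ν : Lp F 2 (volume.restrict (Icc (0 : ℝ) T)))

theorem integrableOn_bilin {a b : ℝ} (ha : 0 ≤ a) (hb : b ≤ T) {u : ℝ → E}
    (hu : ContinuousOn u (Icc a b)) : IntegrableOn (fun s => B (ν s) (u s)) (Icc a b) := by
  have hle : volume.restrict (Icc a b) ≤ volume.restrict (Icc 0 T) :=
    Measure.restrict_mono (Icc_subset_Icc ha hb) le_rfl
  have hν : Integrable ν (volume.restrict (Icc a b)) :=
    ((Lp.memLp ν).integrable (by norm_num)).mono_measure hle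
  obtain ⟨K, hK⟩ := isCompact_Icc.exists_bound_of_continuousOn hu
  refine Integrable.mono' (hν.norm.const_mul (‖B‖ * K)) ?_ ?_
  · exact B.aestronglyMeasurable_comp₂ hν.aestronglyMeasurable
      (hu.aestronglyMeasurable measurableSet_Icc)
  · filter_upwards [ae_restrict_mem measurableSet_Icc] with s hs
    calc ‖B (ν s) (u s)‖ ≤ ‖B‖ * ‖ν s‖ * ‖u s‖ := B.le_opNorm₂ _ _
      _ ≤ ‖B‖ * ‖ν s‖ * K := by gcongr; exact hK s hs
      _ = _ := by ring

theorem intervalIntegrable_bilin {a b : ℝ} (ha : 0 ≤ a) (hab : a ≤ b) (hb : b ≤ T) {u : ℝ → E}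
    (hu : ContinuousOn u (Icc a b)) :
    IntervalIntegrable (fun s => B (ν s) (u s)) volume a b := by
  rw [intervalIntegrable_iff_integrableOn_Icc_of_le hab]
  exact integrableOn_bilin B ν ha hb hu

/-- Cauchy–Schwarz in time. Working with squares trades the merely square-integrable weight `‖ν s‖`
for a constant, so that Grönwall with constant coefficient and Picard iteration become available. -/
theorem sq_norm_integral_bilin_le {a b : ℝ} (ha : 0 ≤ a) (hab : a ≤ b) (hb : b ≤ T) {u : ℝ → E}
    (hu : ContinuousOn u (Icc a b)) :
    ‖∫ s in a..b, B (ν s) (u s)‖ ^ 2 ≤ (‖B‖ * ‖ν‖) ^ 2 * ∫ s in a..b, ‖u s‖ ^ 2 := by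
  have hle : volume.restrict (Icc a b) ≤ volume.restrict (Icc 0 T) :=
    Measure.restrict_mono (Icc_subset_Icc ha hb) le_rfl
  have hν : MemLp (fun s => ‖ν s‖) 2 (volume.restrict (Icc a b)) :=
    ((Lp.memLp ν).mono_measure hle).norm
  have hu2 : MemLp (fun s => ‖u s‖) 2 (volume.restrict (Icc a b)) := by
    obtain ⟨K, hK⟩ := isCompact_Icc.exists_bound_of_continuousOn hu
    refine (MemLp.of_bound (C := K) (hu.aestronglyMeasurable measurableSet_Icc) ?_).norm
    filter_upwards [ae_restrict_mem measurableSet_Icc] with s hs using hK s hs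
  have hcs := integral_mul_le_Lp_mul_Lq_of_nonneg (μ := volume.restrict (Icc a b))
    Real.HolderConjugate.two_two
    (f := fun s => ‖ν s‖) (g := fun s => ‖u s‖)
    (Eventually.of_forall fun _ => norm_nonneg _) (Eventually.of_forall fun _ => norm_nonneg _)
    (by simpa using hν) (by simpa using hu2)
  simp only [Real.rpow_ofNat, ← Real.sqrt_eq_rpow] at hcs
  have h1 : ∫ s in Icc a b, ‖ν s‖ ^ 2 ≤ ‖ν‖ ^ 2 := by
    rw [← integral_sq_norm_eq]
    exact integral_mono_measure hle (Eventually.of_forall fun _ => sq_nonneg _)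
      ((Lp.memLp ν).norm.integrable_sq)
  have h2 : ‖∫ s in a..b, B (ν s) (u s)‖ ≤ ‖B‖ * ∫ s in Icc a b, ‖ν s‖ * ‖u s‖ := by
    rw [intervalIntegral.integral_of_le hab, ← integral_Icc_eq_integral_Ioc, ← integral_const_mul]
    refine norm_integral_le_of_norm_le ((hν.integrable_mul hu2).const_mul _) ?_
    refine Eventually.of_forall fun s => (B.le_opNorm₂ _ _).trans_eq (mul_assoc _ _ _)
  have h3 : ‖∫ s in a..b, B (ν s) (u s)‖
      ≤ ‖B‖ * (‖ν‖ * √(∫ s in Icc a b, ‖u s‖ ^ 2)) := by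
    refine h2.trans (mul_le_mul_of_nonneg_left (hcs.trans ?_) (norm_nonneg B))
    exact mul_le_mul_of_nonneg_right (Real.sqrt_le_iff.mpr ⟨norm_nonneg _, h1⟩)
      (Real.sqrt_nonneg _)
  have h4 : 0 ≤ ∫ s in Icc a b, ‖u s‖ ^ 2 := integral_nonneg fun _ => sq_nonneg _
  calc ‖∫ s in a..b, B (ν s) (u s)‖ ^ 2
      ≤ (‖B‖ * (‖ν‖ * √(∫ s in Icc a b, ‖u s‖ ^ 2))) ^ 2 :=
        pow_le_pow_left₀ (norm_nonneg _) h3 2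
    _ = _ := by
      rw [mul_pow, mul_pow, Real.sq_sqrt h4, intervalIntegral.integral_of_le hab,
        ← integral_Icc_eq_integral_Ioc]
      ring

theorem continuousOn_integral_bilin {a b : ℝ} (ha : 0 ≤ a) (hab : a ≤ b) (hb : b ≤ T)
    {u : ℝ → E} (hu : ContinuousOn u (Icc a b)) :
    ContinuousOn (fun t => ∫ s in a..t, B (ν s) (u s)) (Icc a b) := by
  have := intervalIntegral.continuousOn_primitive_interval
    (f := fun s => B (ν s) (u s)) (μ := volume) (a := a) (b := b)
    (by rw [uIcc_of_le hab]; exact integrableOn_bilin B ν ha hb hu)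
  rwa [uIcc_of_le hab] at this

/-- `u` solves the linear integral equation `u(t) = x + ∫ₐᵗ B(ν(s)) u(s) ds` on `[a, b]`. -/
structure IsVolterraSolution (a b : ℝ) (x : E) (u : ℝ → E) : Prop where
  continuousOn : ContinuousOn u (Icc a b)
  eq : ∀ t ∈ Icc a b, u t = x + ∫ s in a..t, B (ν s) (u s)

/-- Stability with respect to the data of the equation. -/
theorem IsVolterraSolution.sq_norm_sub_le {a b : ℝ} (ha : 0 ≤ a) (hb : b ≤ T)
    {ν₀ : Lp F 2 (volume.restrict (Icc (0 : ℝ) T))} {x y : E} {u v : ℝ → E}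
    (hu : IsVolterraSolution B ν a b x u) (hv : IsVolterraSolution B ν₀ a b y v) {ε : ℝ}
    (hε : ∀ t ∈ Icc a b,
      ‖x - y + ((∫ s in a..t, B (ν s) (v s)) - ∫ s in a..t, B (ν₀ s) (v s))‖ ≤ ε) :
    ∀ t ∈ Icc a b, ‖u t - v t‖ ^ 2
      ≤ 2 * ε ^ 2 * Real.exp (2 * (‖B‖ * ‖ν‖) ^ 2 * (t - a)) := by
  have hsub : ContinuousOn (fun t => u t - v t) (Icc a b) := hu.continuousOn.sub hv.continuousOn
  refine le_mul_exp_of_le_integral (hsub.norm.pow 2) (by positivity) (fun _ _ => sq_nonneg _) ?_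
  intro t ht
  have hat := ht.1
  have htT := ht.2.trans hb
  have hst : Icc a t ⊆ Icc a b := Icc_subset_Icc le_rfl ht.2
  -- The change of control is tested on `v` only; the remaining integral is linear in `u - v` and is
  -- absorbed by Grönwall.
  have h1 : u t - v t = (x - y + ((∫ s in a..t, B (ν s) (v s)) - ∫ s in a..t, B (ν₀ s) (v s)))
      + ∫ s in a..t, B (ν s) (u s - v s) := by
    simp_rw [map_sub]
    rw [intervalIntegral.integral_sub
      (intervalIntegrable_bilin B ν ha hat htT (hu.continuousOn.mono hst))
      (intervalIntegrable_bilin B ν ha hat htT (hv.continuousOn.mono hst)), hu.eq t ht, hv.eq t ht]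
    abel
  have h2 := sq_norm_integral_bilin_le B ν ha hat htT (hsub.mono hst)
  have h3 := hε t ht
  have h4 : ‖u t - v t‖ ≤ ε + ‖∫ s in a..t, B (ν s) (u s - v s)‖ := by
    rw [h1]
    exact (norm_add_le _ _).trans (add_le_add_left h3 _)
  calc ‖u t - v t‖ ^ 2 ≤ (ε + ‖∫ s in a..t, B (ν s) (u s - v s)‖) ^ 2 :=
        pow_le_pow_left₀ (norm_nonneg _) h4 2
    _ ≤ 2 * ε ^ 2 + 2 * ‖∫ s in a..t, B (ν s) (u s - v s)‖ ^ 2 := by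
        nlinarith [sq_nonneg (ε - ‖∫ s in a..t, B (ν s) (u s - v s)‖)]
    _ ≤ _ := by nlinarith [h2]

theorem IsVolterraSolution.eqOn {a b : ℝ} (ha : 0 ≤ a) (hb : b ≤ T) {x : E} {u v : ℝ → E}
    (hu : IsVolterraSolution B ν a b x u) (hv : IsVolterraSolution B ν a b x v) :
    EqOn u v (Icc a b) := by
  intro t ht
  have h := hu.sq_norm_sub_le B ν ha hb hv (ε := 0) (by simp) t ht
  have h2 : ‖u t - v t‖ ^ 2 = 0 := le_antisymm (by simpa using h) (sq_nonneg _)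
  exact sub_eq_zero.mp (norm_eq_zero.mp (pow_eq_zero_iff two_ne_zero |>.mp h2))

/-- The right-hand side of the integral equation, as a self-map of `C([a, b], E)`. -/
noncomputable def picardMap {a b : ℝ} (ha : 0 ≤ a) (hab : a ≤ b) (hb : b ≤ T) (x : E)
    (u : C(Icc a b, E)) : C(Icc a b, E) where
  toFun t := x + ∫ s in a..t, B (ν s) (IccExtend hab u s)
  continuous_toFun := by
    have h := (continuousOn_integral_bilin B ν ha hab hb
      (u.continuous.Icc_extend' (h := hab)).continuousOn).domRestrict
    exact continuous_const.add h

/-- Each iteration integrates the previous bound once, and integrating `(s - a) ^ n` produces the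
next factor of the factorial. -/
theorem sq_norm_iterate_picardMap_sub_le {a b : ℝ} (ha : 0 ≤ a) (hab : a ≤ b) (hb : b ≤ T) (x : E)
    (u v : C(Icc a b, E)) (n : ℕ) (t : Icc a b) :
    ‖((picardMap B ν ha hab hb x)^[n] u) t - ((picardMap B ν ha hab hb x)^[n] v) t‖ ^ 2
      ≤ ((‖B‖ * ‖ν‖) ^ 2 * (t - a)) ^ n / n.factorial * dist u v ^ 2 := by
  induction n generalizing t with
  | zero =>
    simp only [Function.iterate_zero, id_eq, pow_zero, Nat.factorial_zero, Nat.cast_one, div_one,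
      one_mul]
    rw [← dist_eq_norm]
    exact pow_le_pow_left₀ dist_nonneg (ContinuousMap.dist_apply_le_dist t) 2
  | succ n ih =>
    obtain ⟨t, ht⟩ := t
    rw [Function.iterate_succ_apply', Function.iterate_succ_apply']
    set p := (picardMap B ν ha hab hb x)^[n] u
    set q := (picardMap B ν ha hab hb x)^[n] v
    have hp : Continuous (IccExtend hab p) := p.continuous.Icc_extend'
    have hq : Continuous (IccExtend hab q) := q.continuous.Icc_extend'
    have htT := ht.2.trans hb
    have h1 : picardMap B ν ha hab hb x p ⟨t, ht⟩ - picardMap B ν ha hab hb x q ⟨t, ht⟩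
        = ∫ s in a..t, B (ν s) (IccExtend hab p s - IccExtend hab q s) := by
      simp_rw [map_sub]
      rw [intervalIntegral.integral_sub
        (intervalIntegrable_bilin B ν ha ht.1 htT hp.continuousOn)
        (intervalIntegrable_bilin B ν ha ht.1 htT hq.continuousOn)]
      change (x + _) - (x + _) = _
      abel
    rw [h1]
    refine (sq_norm_integral_bilin_le B ν ha ht.1 htT (hp.sub hq).continuousOn).trans ?_
    have h2 : ∫ s in a..t, ‖IccExtend hab p s - IccExtend hab q s‖ ^ 2
        ≤ ∫ s in a..t, ((‖B‖ * ‖ν‖) ^ 2 * (s - a)) ^ n / n.factorial * dist u v ^ 2 := by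
      refine intervalIntegral.integral_mono_on ht.1
        (((hp.sub hq).norm.pow 2).intervalIntegrable _ _)
        (Continuous.intervalIntegrable (by fun_prop) _ _) fun s hs => ?_
      have hs' : s ∈ Icc a b := ⟨hs.1, hs.2.trans ht.2⟩
      rw [IccExtend_of_mem hab p hs', IccExtend_of_mem hab q hs']
      exact ih ⟨s, hs'⟩
    have h3 : ∫ s in a..t, ((‖B‖ * ‖ν‖) ^ 2 * (s - a)) ^ n / n.factorial * dist u v ^ 2
        = ((‖B‖ * ‖ν‖) ^ 2) ^ n * ((t - a) ^ (n + 1) / (n + 1)) / n.factorial * dist u v ^ 2 := by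
      simp_rw [mul_pow _ (_ - a), div_eq_mul_inv]
      rw [intervalIntegral.integral_mul_const, intervalIntegral.integral_mul_const,
        intervalIntegral.integral_const_mul,
        intervalIntegral.integral_comp_sub_right (fun s => s ^ n) a, integral_pow]
      simp [div_eq_mul_inv]
    calc _ ≤ (‖B‖ * ‖ν‖) ^ 2 * _ := mul_le_mul_of_nonneg_left h2 (sq_nonneg _)
      _ = _ := by
        rw [h3, Nat.factorial_succ, mul_pow _ (t - a)]
        push_cast
        field_simp
        ring

/-- Since `D ^ n / n! → 0`, some iterate of the Picard map is a contraction, however large `ν` or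
the interval is. -/
theorem exists_isVolterraSolution [CompleteSpace E] {a b : ℝ} (ha : 0 ≤ a) (hab : a ≤ b)
    (hb : b ≤ T) (x : E) : ∃ u, IsVolterraSolution B ν a b x u := by
  set D : ℝ := (‖B‖ * ‖ν‖) ^ 2 * (b - a)
  have hD : 0 ≤ D := mul_nonneg (sq_nonneg (‖B‖ * ‖ν‖)) (sub_nonneg.mpr hab)
  -- The threshold is `(1 / 2) ^ 2` because the iterates are estimated in squared norm.
  obtain ⟨n, hn⟩ := ((FloorSemiring.tendsto_pow_div_factorial_atTop D).eventually
    (gt_mem_nhds (by norm_num : (0 : ℝ) < (1 / 2) ^ 2))).exists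
  have hc : ContractingWith (1 / 2) (picardMap B ν ha hab hb x)^[n] := by
    refine ⟨by rw [← NNReal.coe_lt_coe]; norm_num, LipschitzWith.of_dist_le_mul fun u v => ?_⟩
    rw [ContinuousMap.dist_le (by positivity)]
    intro t
    rw [dist_eq_norm]
    refine (sq_le_sq₀ (norm_nonneg _) (by positivity)).mp ?_
    refine (sq_norm_iterate_picardMap_sub_le B ν ha hab hb x u v n t).trans ?_
    rw [mul_pow _ (dist u v)]
    refine mul_le_mul_of_nonneg_right ?_ (sq_nonneg (dist u v))
    have h1 : ((‖B‖ * ‖ν‖) ^ 2 * ((t : ℝ) - a)) ^ n / n.factorial ≤ D ^ n / n.factorial := by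
      have h2 := t.2.1
      have h3 := t.2.2
      exact div_le_div_of_nonneg_right (pow_le_pow_left₀
        (mul_nonneg (sq_nonneg (‖B‖ * ‖ν‖)) (by linarith))
        (mul_le_mul_of_nonneg_left (by linarith) (sq_nonneg (‖B‖ * ‖ν‖))) n) (by positivity)
    push_cast
    linarith
  have : Nonempty C(Icc a b, E) := ⟨0⟩
  -- The unique fixed point of the iterate is fixed by the Picard map itself.
  have hfix := hc.isFixedPt_fixedPoint_iterate
  set p := ContractingWith.fixedPoint _ hc
  refine ⟨IccExtend hab p, (p.continuous.Icc_extend' (h := hab)).continuousOn, fun t ht => ?_⟩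
  rw [IccExtend_of_mem hab p ht]
  conv_lhs => rw [← hfix.eq]
  rfl

end Volterra

/-! ### Weak convergence of controls and uniform convergence of solutions -/

section WeakConvergence

variable {E F : Type*} [NormedAddCommGroup E] [NormedSpace ℝ E]
  [NormedAddCommGroup F] [InnerProductSpace ℝ F] {T : ℝ} (B : F →L[ℝ] E →L[ℝ] E)

/-- The map `ν ↦ ∫ₐᵗ B(ν(s)) u(s) ds`. -/
noncomputable def integralBilin {a t : ℝ} (ha : 0 ≤ a) (hat : a ≤ t) (ht : t ≤ T) {u : ℝ → E}
    (hu : ContinuousOn u (Icc a t)) : Lp F 2 (volume.restrict (Icc (0 : ℝ) T)) →L[ℝ] E :=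
  LinearMap.mkContinuous
    { toFun := fun ν => ∫ s in a..t, B (ν s) (u s)
      map_add' := fun ν ρ => by
        rw [← intervalIntegral.integral_add (intervalIntegrable_bilin B ν ha hat ht hu)
          (intervalIntegrable_bilin B ρ ha hat ht hu)]
        refine intervalIntegral.integral_congr_ae_restrict ?_
        have hle : volume.restrict (uIoc a t) ≤ volume.restrict (Icc 0 T) := by
          rw [uIoc_of_le hat]
          exact Measure.restrict_mono
            (Ioc_subset_Icc_self.trans (Icc_subset_Icc ha ht)) le_rfl
        filter_upwards [ae_mono hle (Lp.coeFn_add ν ρ)] with s hs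
        rw [hs, Pi.add_apply, map_add, add_apply]
      map_smul' := fun c ν => by
        rw [RingHom.id_apply, ← intervalIntegral.integral_smul]
        refine intervalIntegral.integral_congr_ae_restrict ?_
        have hle : volume.restrict (uIoc a t) ≤ volume.restrict (Icc 0 T) := by
          rw [uIoc_of_le hat]
          exact Measure.restrict_mono
            (Ioc_subset_Icc_self.trans (Icc_subset_Icc ha ht)) le_rfl
        filter_upwards [ae_mono hle (Lp.coeFn_smul c ν)] with s hs
        rw [hs, Pi.smul_apply, map_smul, smul_apply] }
    (‖B‖ * √(∫ s in a..t, ‖u s‖ ^ 2)) fun ν => by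
      have h0 : 0 ≤ ∫ s in a..t, ‖u s‖ ^ 2 :=
        intervalIntegral.integral_nonneg hat fun _ _ => sq_nonneg _
      refine (sq_le_sq₀ (norm_nonneg _) (by positivity)).mp ?_
      refine (sq_norm_integral_bilin_le B ν ha hat ht hu).trans_eq ?_
      rw [mul_pow, mul_pow, mul_pow, Real.sq_sqrt h0]
      ring

variable [FiniteDimensional ℝ E] {ι : Type*} {l : Filter ι}

/-- In a finite-dimensional space weak convergence is convergence. -/
theorem tendsto_of_forall_strongDual {G : Type*} [NormedAddCommGroup G] [NormedSpace ℝ G]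
    (A : G →L[ℝ] E) {x : ι → G} {x₀ : G}
    (h : ∀ φ : StrongDual ℝ G, Tendsto (fun i => φ (x i)) l (𝓝 (φ x₀))) :
    Tendsto (fun i => A (x i)) l (𝓝 (A x₀)) := by
  set e := (Module.finBasis ℝ E).equivFunL
  have h1 : Tendsto (fun i => e (A (x i))) l (𝓝 (e (A x₀))) := by
    rw [tendsto_pi_nhds]
    intro k
    exact h ((ContinuousLinearMap.proj (R := ℝ) (φ := fun _ => ℝ) k).comp
      ((e : E →L[ℝ] (Fin (Module.finrank ℝ E) → ℝ)).comp A))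
  simpa [Function.comp_def] using (e.symm.continuous.tendsto _).comp h1

variable {ν : ι → Lp F 2 (volume.restrict (Icc (0 : ℝ) T))}
  {ν₀ : Lp F 2 (volume.restrict (Icc (0 : ℝ) T))} {r : ℝ}

/-- At a fixed time the integral is a bounded linear map of the control into a finite-dimensional
space, so weak convergence gives convergence. By Cauchy–Schwarz and the bound `r` the integrals are
1/2-Hölder in time with a common constant, and equicontinuity on the compact interval makes the
convergence uniform. -/
theorem tendstoUniformlyOn_integral_bilin (hr : ∀ i, ‖ν i‖ ≤ r)
    (hν : ∀ φ : StrongDual ℝ (Lp F 2 (volume.restrict (Icc (0 : ℝ) T))),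
      Tendsto (fun i => φ (ν i)) l (𝓝 (φ ν₀)))
    {a b : ℝ} (ha : 0 ≤ a) (hb : b ≤ T) {u : ℝ → E} (hu : ContinuousOn u (Icc a b)) :
    TendstoUniformlyOn (fun i t => ∫ s in a..t, B (ν i s) (u s))
      (fun t => ∫ s in a..t, B (ν₀ s) (u s)) l (Icc a b) := by
  obtain ⟨K, hK⟩ := isCompact_Icc.exists_bound_of_continuousOn hu
  set f : ι → Icc a b → E := fun i t => ∫ s in a..t, B (ν i s) (u s)
  have hsq : ∀ i (t t' : Icc a b), (t : ℝ) ≤ t' →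
      ‖f i t - f i t'‖ ^ 2 ≤ (‖B‖ * r) ^ 2 * K ^ 2 * |(t : ℝ) - t'| := by
    intro i t t' htt
    have h1 : f i t' - f i t = ∫ s in t..t', B (ν i s) (u s) := by
      refine intervalIntegral.integral_interval_sub_left
        (intervalIntegrable_bilin B _ ha t'.2.1 (t'.2.2.trans hb)
          (hu.mono (Icc_subset_Icc le_rfl t'.2.2)))
        (intervalIntegrable_bilin B _ ha t.2.1 (t.2.2.trans hb)
          (hu.mono (Icc_subset_Icc le_rfl t.2.2)))
    have hsub : Icc (t : ℝ) t' ⊆ Icc a b := Icc_subset_Icc t.2.1 t'.2.2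
    have h2 : ∫ s in t..t', ‖u s‖ ^ 2 ≤ ∫ s in (t : ℝ)..t', K ^ 2 := by
      refine intervalIntegral.integral_mono_on htt ?_ (by simp) fun s hs =>
        pow_le_pow_left₀ (norm_nonneg _) (hK s (hsub hs)) 2
      refine ContinuousOn.intervalIntegrable ?_
      rw [uIcc_of_le htt]
      exact (hu.mono hsub).norm.pow 2
    have h0 : 0 ≤ ∫ s in (t : ℝ)..t', ‖u s‖ ^ 2 :=
      intervalIntegral.integral_nonneg htt fun _ _ => sq_nonneg _
    rw [norm_sub_rev, h1]
    refine (sq_norm_integral_bilin_le B (ν i) (ha.trans t.2.1) htt (t'.2.2.trans hb)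
      (hu.mono hsub)).trans ?_
    rw [intervalIntegral.integral_const, smul_eq_mul] at h2
    rw [abs_sub_comm, abs_of_nonneg (sub_nonneg.mpr htt), mul_assoc]
    have h3 : (‖B‖ * ‖ν i‖) ^ 2 ≤ (‖B‖ * r) ^ 2 :=
      pow_le_pow_left₀ (by positivity) (mul_le_mul_of_nonneg_left (hr i) (norm_nonneg B)) 2
    exact mul_le_mul h3 (h2.trans_eq (mul_comm _ _)) h0 (sq_nonneg _)
  have hsq' : ∀ i (t t' : Icc a b),
      ‖f i t - f i t'‖ ^ 2 ≤ (‖B‖ * r) ^ 2 * K ^ 2 * |(t : ℝ) - t'| := by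
    intro i t t'
    rcases le_total (t : ℝ) t' with h | h
    · exact hsq i t t' h
    · rw [norm_sub_rev, abs_sub_comm]
      exact hsq i t' t h
  have heq : Equicontinuous f := by
    refine Metric.equicontinuous_of_continuity_modulus
      (fun d => √((‖B‖ * r) ^ 2 * K ^ 2 * d)) ?_ f ?_
    · have : Continuous fun d : ℝ => √((‖B‖ * r) ^ 2 * K ^ 2 * d) := by fun_prop
      simpa using this.tendsto 0
    · intro t t' i
      rw [dist_eq_norm]
      exact Real.le_sqrt_of_sq_le (hsq' i t t')
  have hpt : Tendsto f l (𝓝 fun t : Icc a b => ∫ s in a..t, B (ν₀ s) (u s)) := by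
    rw [tendsto_pi_nhds]
    intro t
    exact tendsto_of_forall_strongDual (integralBilin B ha t.2.1 (t.2.2.trans hb)
      (hu.mono (Icc_subset_Icc le_rfl t.2.2))) hν
  -- On an equicontinuous family over a compact space, pointwise and uniform convergence coincide.
  have h := (heq.tendsto_uniformFun_iff_pi l _).mpr hpt
  rw [UniformFun.tendsto_iff_tendstoUniformly] at h
  rw [tendstoUniformlyOn_iff_tendstoUniformly_comp_coe]
  exact h

/-- The solution depends continuously on the initial value and, for the weak topology of
bounded sets, on the control. -/
theorem IsVolterraSolution.tendstoUniformlyOn (hr : ∀ i, ‖ν i‖ ≤ r)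
    (hν : ∀ φ : StrongDual ℝ (Lp F 2 (volume.restrict (Icc (0 : ℝ) T))),
      Tendsto (fun i => φ (ν i)) l (𝓝 (φ ν₀)))
    {a b : ℝ} (ha : 0 ≤ a) (hb : b ≤ T) {x : ι → E} {x₀ : E} {u : ι → ℝ → E} {u₀ : ℝ → E}
    (hx : Tendsto x l (𝓝 x₀)) (hu : ∀ i, IsVolterraSolution B (ν i) a b (x i) (u i))
    (hu₀ : IsVolterraSolution B ν₀ a b x₀ u₀) : TendstoUniformlyOn u u₀ l (Icc a b) := by
  -- Only the fixed limit solution enters the integrand, so weak convergence of the controls is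
  -- enough.
  have hi := tendstoUniformlyOn_integral_bilin B hr hν ha hb hu₀.continuousOn
  rw [Metric.tendstoUniformlyOn_iff] at hi ⊢
  intro η hη
  -- The Grönwall factor is taken with `r` in place of `‖ν i‖`, so one `ε` serves all indices.
  obtain ⟨ε, hε, hε'⟩ : ∃ ε > 0,
      2 * ε ^ 2 * Real.exp (2 * (‖B‖ * r) ^ 2 * (b - a)) < η ^ 2 := by
    have hc : Continuous fun ε : ℝ =>
      2 * ε ^ 2 * Real.exp (2 * (‖B‖ * r) ^ 2 * (b - a)) := by fun_prop
    have h0 : Tendsto (fun ε : ℝ => 2 * ε ^ 2 * Real.exp (2 * (‖B‖ * r) ^ 2 * (b - a)))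
        (𝓝[>] 0) (𝓝 0) := by
      simpa using (hc.tendsto 0).mono_left (nhdsWithin_le_nhds (s := Ioi 0))
    obtain ⟨ε, h1, h2⟩ := ((h0.eventually (gt_mem_nhds (pow_pos hη 2))).and
      self_mem_nhdsWithin).exists
    exact ⟨ε, h2, h1⟩
  filter_upwards [hi (ε / 2) (half_pos hε), Metric.tendsto_nhds.mp hx (ε / 2) (half_pos hε)]
    with i h1 h2 t ht
  have h3 := (hu i).sq_norm_sub_le B (ν i) ha hb hu₀ (ε := ε) (fun s hs => by
    have h4 := h1 s hs
    rw [dist_comm, dist_eq_norm] at h4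
    rw [dist_eq_norm] at h2
    exact (norm_add_le _ _).trans (by linarith)) t ht
  rw [dist_comm, dist_eq_norm]
  refine lt_of_pow_lt_pow_left₀ 2 hη.le (h3.trans_lt (lt_of_le_of_lt ?_ hε'))
  have h5 : (‖B‖ * ‖ν i‖) ^ 2 ≤ (‖B‖ * r) ^ 2 :=
    pow_le_pow_left₀ (by positivity) (mul_le_mul_of_nonneg_left (hr i) (norm_nonneg B)) 2
  gcongr
  · exact sub_nonneg.mpr ht.1
  · exact ht.2

end WeakConvergence

/-! ### The basis of eigenfunctions -/

theorem integral_cos_int_mul_pi {n : ℤ} (hn : n ≠ 0) :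
    ∫ x in (0 : ℝ)..1, Real.cos (n * Real.pi * x) = 0 := by
  have hc : (n * Real.pi : ℝ) ≠ 0 := mul_ne_zero (Int.cast_ne_zero.mpr hn) Real.pi_ne_zero
  rw [intervalIntegral.integral_comp_mul_left _ hc, integral_cos]
  simp [Real.sin_int_mul_pi]

/-- Product-to-sum turns the integrand into two cosines. The condition on `j` keeps the frequency `j
+ k` from vanishing. -/
theorem integral_sine_mul_sine {j k : ℕ} (hj : j ≠ 0) :
    ∫ x, sine j x * sine k x ∂dom = if j = k then 1 else 0 := by
  have h1 : ∀ x, sine j x * sine k x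
      = Real.cos (((j - k : ℤ) : ℝ) * Real.pi * x)
        - Real.cos (((j + k : ℤ) : ℝ) * Real.pi * x) := by
    intro x
    have h2 : Real.sqrt 2 * Real.sqrt 2 = 2 := Real.mul_self_sqrt (by norm_num)
    push_cast
    rw [sub_mul, sub_mul, add_mul, add_mul, Real.cos_sub, Real.cos_add, sine, sine]
    linear_combination Real.sin (j * Real.pi * x) * Real.sin (k * Real.pi * x) * h2
  simp_rw [h1]
  rw [← integral_Ioc_eq_integral_Ioo, ← intervalIntegral.integral_of_le zero_le_one,
    intervalIntegral.integral_sub (Continuous.intervalIntegrable (by fun_prop) _ _)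
      (Continuous.intervalIntegrable (by fun_prop) _ _),
    integral_cos_int_mul_pi (n := j + k) (by omega), sub_zero]
  split_ifs with h
  · simp [h]
  · exact integral_cos_int_mul_pi (by omega)

theorem inner_mode_mode {j k : ℕ} (hj : j ≠ 0) :
    ⟪mode j, mode k⟫_ℂ = if j = k then 1 else 0 := by
  rw [L2.inner_def]
  have h : (fun x => ⟪(mode j : CplxL2) x, (mode k : CplxL2) x⟫_ℂ)
      =ᵐ[dom] fun x => ((sine j x * sine k x : ℝ) : ℂ) := by
    filter_upwards [(sine_memLp j).coeFn_toLp, (sine_memLp k).coeFn_toLp] with x h1 h2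
    change ⟪((sine_memLp j).toLp _ : CplxL2) x, ((sine_memLp k).toLp _ : CplxL2) x⟫_ℂ = _
    rw [h1, h2, RCLike.inner_apply, Complex.conj_ofReal]
    push_cast
    ring
  rw [integral_congr_ae h, integral_complex_ofReal, integral_sine_mul_sine hj]
  split_ifs <;> simp

theorem orthonormal_gmode (N : ℕ) : Orthonormal ℂ (gmode : Fin N → Galerkin N) := by
  rw [orthonormal_iff_ite]
  intro j k
  change ⟪mode (j + 1), mode (k + 1)⟫_ℂ = _
  rw [inner_mode_mode (Nat.succ_ne_zero _)]
  simp [Fin.ext_iff]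

theorem span_range_gmode (N : ℕ) :
    ⊤ ≤ Submodule.span ℂ (range (gmode : Fin N → Galerkin N)) := by
  rintro ⟨u, hu⟩ -
  have h : (GalerkinSubmodule N).subtype '' range (gmode : Fin N → Galerkin N)
      = range fun k : Fin N => mode (k + 1) := by
    rw [← range_comp]
    rfl
  have h2 := hu
  rw [GalerkinSubmodule, ← h, Submodule.span_image] at h2
  obtain ⟨v, hv, hvu⟩ := h2
  have : v = ⟨u, hu⟩ := Subtype.ext hvu
  exact this ▸ hv

/-- The eigenfunctions as an orthonormal basis of `H_N`. -/
noncomputable def gbasis (N : ℕ) : OrthonormalBasis (Fin N) ℂ (Galerkin N) :=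
  OrthonormalBasis.mk (orthonormal_gmode N) (span_range_gmode N)

@[simp]
theorem gbasis_apply {N : ℕ} (k : Fin N) : gbasis N k = gmode k := by simp [gbasis]

/-! ### The Laplacian and the semigroup -/

section Concrete

variable {N : ℕ}

theorem inner_galerkin_smul (c : ℂ) (u v : Galerkin N) : ⟪v, c • u⟫_ℂ = c * ⟪v, u⟫_ℂ :=
  inner_smul_right (v : CplxL2) (u : CplxL2) c

theorem continuous_inner_galerkin (v : Galerkin N) : Continuous fun u : Galerkin N => ⟪v, u⟫_ℂ :=
  (continuous_const (y := (v : CplxL2))).inner continuous_subtype_val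

instance : FiniteDimensional ℝ (Galerkin N) := FiniteDimensional.complexToReal _

theorem lap_add (u v : Galerkin N) : lap (u + v) = lap u + lap v := by
  simp only [lap, inner_add_right, mul_add, add_smul, Finset.sum_add_distrib]

theorem lap_smul (c : ℂ) (u : Galerkin N) : lap (c • u) = c • lap u := by
  simp only [lap, inner_galerkin_smul, Finset.smul_sum, smul_smul]
  refine Finset.sum_congr rfl fun k _ => ?_
  congr 1
  ring

theorem exists_norm_lap_le (N : ℕ) : ∃ K, ∀ u : Galerkin N, ‖lap u‖ ≤ K * ‖u‖ := by
  let L : Galerkin N →ₗ[ℂ] Galerkin N :=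
    { toFun := lap, map_add' := lap_add, map_smul' := lap_smul }
  exact ⟨‖L.toContinuousLinearMap‖, fun u => L.toContinuousLinearMap.le_opNorm u⟩

@[simp]
theorem inner_gmode_semigroup (t : ℝ) (u : Galerkin N) (k : Fin N) :
    ⟪gmode k, semigroup t u⟫_ℂ
      = Complex.exp (-(Complex.I * t * eigval (k + 1))) * ⟪gmode k, u⟫_ℂ := by
  rw [semigroup, inner_sum]
  simp only [inner_galerkin_smul, orthonormal_iff_ite.mp (orthonormal_gmode N), mul_ite, mul_one,
    mul_zero, Finset.sum_ite_eq, Finset.mem_univ, if_true]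

theorem semigroup_zero (u : Galerkin N) : semigroup 0 u = u := by
  conv_rhs => rw [← (gbasis N).sum_repr' u]
  simp [semigroup]

theorem semigroup_add (t : ℝ) (u v : Galerkin N) :
    semigroup t (u + v) = semigroup t u + semigroup t v := by
  simp only [semigroup, inner_add_right, mul_add, add_smul, Finset.sum_add_distrib]

theorem semigroup_smul (t : ℝ) (c : ℂ) (u : Galerkin N) :
    semigroup t (c • u) = c • semigroup t u := by
  simp only [semigroup, inner_galerkin_smul, Finset.smul_sum, smul_smul]
  refine Finset.sum_congr rfl fun k _ => ?_
  congr 1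
  ring

/-- Parseval: every Fourier coefficient is multiplied by a number of modulus one. -/
theorem norm_semigroup (t : ℝ) (u : Galerkin N) : ‖semigroup t u‖ = ‖u‖ := by
  rw [← sq_eq_sq₀ (norm_nonneg _) (norm_nonneg _), ← (gbasis N).sum_sq_norm_inner_right,
    ← (gbasis N).sum_sq_norm_inner_right u]
  refine Finset.sum_congr rfl fun k _ => ?_
  have h : -(Complex.I * t * eigval (k + 1)) = ((-(t * eigval (k + 1)) : ℝ) : ℂ) * Complex.I := by
    push_cast
    ring
  rw [gbasis_apply, inner_gmode_semigroup, norm_mul, h, Complex.norm_exp_ofReal_mul_I, one_mul]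

theorem continuous_semigroup (t : ℝ) : Continuous (semigroup t : Galerkin N → Galerkin N) := by
  unfold semigroup
  refine continuous_finsetSum _ fun k _ => ?_
  exact ((continuous_inner_galerkin (gmode k)).const_mul _).smul continuous_const

theorem hasDerivAt_semigroup (t : ℝ) (u : Galerkin N) :
    HasDerivAt (fun t => semigroup t u) (Complex.I • lap (semigroup t u)) t := by
  have h : Complex.I • lap (semigroup t u) = ∑ k : Fin N,
      (Complex.exp (-(Complex.I * t * eigval (k + 1))) * (-(Complex.I * 1 * eigval (k + 1)))
        * ⟪gmode k, u⟫_ℂ) • gmode k := by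
    rw [lap, Finset.smul_sum]
    refine Finset.sum_congr rfl fun k _ => ?_
    rw [inner_gmode_semigroup, smul_smul]
    congr 1
    ring
  rw [h]
  refine HasDerivAt.fun_sum fun k _ => ?_
  have h1 : HasDerivAt (fun t : ℝ => (t : ℂ)) 1 t := Complex.ofRealCLM.hasDerivAt
  exact ((((h1.const_mul Complex.I).mul_const _).neg.cexp).mul_const _).smul_const _

/-! ### The nonlinearity and the product -/

/-- The inclusion of `H_N` into `L^∞` is linear on a finite-dimensional space, hence bounded. This
inverse estimate controls both the cubic term and the product with the control. -/
theorem exists_ae_norm_le (N : ℕ) :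
    ∃ K, 0 ≤ K ∧ ∀ u : Galerkin N, ∀ᵐ x ∂dom, ‖(u : CplxL2) x‖ ≤ K * ‖u‖ := by
  have hmem : ∀ u : Galerkin N, MemLp (u : CplxL2) ∞ dom := fun u => by
    obtain ⟨C, hC⟩ := galerkin_bound u
    exact memLp_top_of_bound (Lp.aestronglyMeasurable _) C hC
  let L : Galerkin N →ₗ[ℂ] Lp ℂ ∞ dom :=
    { toFun := fun u => (hmem u).toLp _
      map_add' := fun u v => by
        rw [← MemLp.toLp_add]
        exact MemLp.toLp_congr _ _ (Lp.coeFn_add (u : CplxL2) v)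
      map_smul' := fun c u => by
        rw [RingHom.id_apply, ← MemLp.toLp_const_smul]
        exact MemLp.toLp_congr _ _ (Lp.coeFn_smul c (u : CplxL2)) }
  refine ⟨‖L.toContinuousLinearMap‖, norm_nonneg L.toContinuousLinearMap, fun u => ?_⟩
  have h1 : ‖L u‖ ≤ ‖L.toContinuousLinearMap‖ * ‖u‖ := L.toContinuousLinearMap.le_opNorm u
  filter_upwards [(hmem u).coeFn_toLp, enorm_ae_le_eLpNormEssSup (L u) dom] with x hx hx'
  rw [← hx]
  refine le_trans ?_ h1
  rw [Lp.norm_def, eLpNorm_exponent_top, ← toReal_enorm]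
  refine ENNReal.toReal_mono ?_ hx'
  rw [← eLpNorm_exponent_top]
  exact Lp.eLpNorm_ne_top _

theorem norm_cube_sub_cube_le {a b : ℂ} {m : ℝ} (ha : ‖a‖ ≤ m) (hb : ‖b‖ ≤ m) :
    ‖((‖a‖ ^ 2 : ℝ) : ℂ) * a - ((‖b‖ ^ 2 : ℝ) : ℂ) * b‖ ≤ 3 * m ^ 2 * ‖a - b‖ := by
  have hm : 0 ≤ m := (norm_nonneg a).trans ha
  have h1 : ((‖a‖ ^ 2 : ℝ) : ℂ) * a - ((‖b‖ ^ 2 : ℝ) : ℂ) * b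
      = ((‖a‖ ^ 2 : ℝ) : ℂ) * (a - b) + (((‖a‖ + ‖b‖) * (‖a‖ - ‖b‖) : ℝ) : ℂ) * b := by
    push_cast
    ring
  have h2 : |‖a‖ - ‖b‖| ≤ ‖a - b‖ := abs_norm_sub_norm_le a b
  rw [h1]
  refine (norm_add_le _ _).trans ?_
  rw [norm_mul, norm_mul, Complex.norm_real, Complex.norm_real, norm_mul, norm_pow, norm_norm,
    Real.norm_of_nonneg (add_nonneg (norm_nonneg a) (norm_nonneg b)), Real.norm_eq_abs]
  calc ‖a‖ ^ 2 * ‖a - b‖ + (‖a‖ + ‖b‖) * |‖a‖ - ‖b‖| * ‖b‖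
      ≤ m ^ 2 * ‖a - b‖ + (m + m) * ‖a - b‖ * m := by gcongr
    _ = _ := by ring

/-- On the unit ball around `u` the functions have a common sup bound `m`, and there the pointwise
cubic map is Lipschitz with constant `3 m²`. -/
theorem continuous_cubic : Continuous (cubic : Galerkin N → CplxL2) := by
  obtain ⟨K, hK, hbd⟩ := exists_ae_norm_le N
  rw [continuous_iff_continuousAt]
  intro u
  set m : ℝ := K * (‖u‖ + 1)
  refine continuousAt_of_locally_lipschitz one_pos
    ((measureUnivNNReal dom : ℝ) ^ (2 : ℝ≥0∞).toReal⁻¹ * (3 * m ^ 2 * K)) fun v hv => ?_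
  have hv' : ‖v‖ ≤ ‖u‖ + 1 := by
    rw [dist_eq_norm] at hv
    have := norm_le_norm_add_norm_sub' v u
    linarith
  rw [dist_eq_norm, dist_eq_norm, mul_assoc]
  refine Lp.norm_le_of_ae_bound (by positivity) ?_
  filter_upwards [hbd u, hbd v, hbd (v - u), (cubic_memLp u).coeFn_toLp, (cubic_memLp v).coeFn_toLp,
    Lp.coeFn_sub (cubic v) (cubic u), Lp.coeFn_sub (v : CplxL2) u] with x h1 h2 h3 h4 h5 h6 h7
  rw [h6, Pi.sub_apply]
  change ‖((cubic_memLp v).toLp _ : CplxL2) x - ((cubic_memLp u).toLp _ : CplxL2) x‖ ≤ _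
  rw [h4, h5]
  have h8 : ‖(v : CplxL2) x - (u : CplxL2) x‖ ≤ K * ‖v - u‖ := by
    rw [← Pi.sub_apply, ← h7]
    exact h3
  refine (norm_cube_sub_cube_le (h2.trans (mul_le_mul_of_nonneg_left hv' hK))
    (h1.trans (mul_le_mul_of_nonneg_left (by linarith) hK))).trans ?_
  rw [mul_assoc _ K]
  exact mul_le_mul_of_nonneg_left h8 (by positivity)

theorem pot_ae (u : Galerkin N) (v : RealL2) :
    (pot u v : CplxL2) =ᵐ[dom] fun x => (u : CplxL2) x * ((v x : ℝ) : ℂ) :=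
  (pot_memLp u v).coeFn_toLp

theorem pot_add_left (u w : Galerkin N) (v : RealL2) : pot (u + w) v = pot u v + pot w v := by
  refine Lp.ext ?_
  filter_upwards [pot_ae (u + w) v, pot_ae u v, pot_ae w v, Lp.coeFn_add (pot u v) (pot w v),
    Lp.coeFn_add (u : CplxL2) w] with x h1 h2 h3 h4 h5
  rw [h1, h4, Pi.add_apply, h2, h3, ← add_mul, ← Pi.add_apply, ← h5]
  rfl

theorem pot_add_right (u : Galerkin N) (v w : RealL2) : pot u (v + w) = pot u v + pot u w := by
  refine Lp.ext ?_
  filter_upwards [pot_ae u (v + w), pot_ae u v, pot_ae u w, Lp.coeFn_add (pot u v) (pot u w),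
    Lp.coeFn_add v w] with x h1 h2 h3 h4 h5
  rw [h1, h4, Pi.add_apply, h2, h3, ← mul_add, h5, Pi.add_apply, Complex.ofReal_add]

theorem pot_smul_left (c : ℝ) (u : Galerkin N) (v : RealL2) : pot (c • u) v = c • pot u v := by
  refine Lp.ext ?_
  filter_upwards [pot_ae (c • u) v, pot_ae u v, Lp.coeFn_smul c (pot u v),
    Lp.coeFn_smul c (u : CplxL2)] with x h1 h2 h3 h4
  rw [h1, h3, Pi.smul_apply, h2, ← smul_mul_assoc, ← Pi.smul_apply, ← h4]
  rfl

theorem pot_smul_right (c : ℝ) (u : Galerkin N) (v : RealL2) : pot u (c • v) = c • pot u v := by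
  refine Lp.ext ?_
  filter_upwards [pot_ae u (c • v), pot_ae u v, Lp.coeFn_smul c (pot u v),
    Lp.coeFn_smul c v] with x h1 h2 h3 h4
  rw [h1, h3, Pi.smul_apply, h2, h4, Pi.smul_apply, smul_eq_mul, Complex.ofReal_mul,
    Complex.real_smul]
  ring

theorem exists_norm_pot_le (N : ℕ) :
    ∃ K, 0 ≤ K ∧ ∀ (u : Galerkin N) (v : RealL2), ‖pot u v‖ ≤ K * ‖u‖ * ‖v‖ := by
  obtain ⟨K, hK, hbd⟩ := exists_ae_norm_le N
  refine ⟨K, hK, fun u v => Lp.norm_le_mul_norm_of_ae_le_mul ?_⟩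
  filter_upwards [hbd u, pot_ae u v] with x h1 h2
  rw [h2, norm_mul, Complex.norm_real]
  exact mul_le_mul_of_nonneg_right h1 (norm_nonneg _)

/-- The bilinear map `(v, u) ↦ -i P^N(u v)` on `H₀ × H_N`. -/
noncomputable def controlMap (N : ℕ) (R : RealL2 →L[ℝ] RealL2) :
    CamSpace R →L[ℝ] Galerkin N →L[ℝ] Galerkin N :=
  LinearMap.mkContinuous₂
    (LinearMap.mk₂ ℝ (fun v u => -Complex.I • proj N (pot u (CamSpace.incl R v)))
      (fun v w u => by rw [map_add, pot_add_right, map_add, smul_add])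
      (fun c v u => by
        rw [map_smul, pot_smul_right, (proj N).map_smul_of_tower, smul_comm])
      (fun v u w => by rw [pot_add_left, map_add, smul_add])
      (fun c v u => by
        rw [pot_smul_left, (proj N).map_smul_of_tower, smul_comm]))
    (‖proj N‖ * (exists_norm_pot_le N).choose * ‖R‖) fun v u => by
      obtain ⟨hK, hpot⟩ := (exists_norm_pot_le N).choose_spec
      set K := (exists_norm_pot_le N).choose
      rw [LinearMap.mk₂_apply, norm_smul, norm_neg, Complex.norm_I, one_mul]
      calc ‖proj N (pot u (CamSpace.incl R v))‖
          ≤ ‖proj N‖ * ‖pot u (CamSpace.incl R v)‖ := (proj N).le_opNorm _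
        _ ≤ ‖proj N‖ * (K * ‖u‖ * (‖R‖ * ‖v‖)) := by
          refine mul_le_mul_of_nonneg_left ((hpot _ _).trans ?_) (norm_nonneg (proj N))
          exact mul_le_mul_of_nonneg_left (CamSpace.norm_incl_le R v)
            (mul_nonneg hK (norm_nonneg u))
        _ = _ := by ring

end Concrete

/-! ### The deterministic step -/

section DetStep

variable {N : ℕ}

/-- The solution of the deterministic subequation at time `s` after the start in `w`. -/
noncomputable def detStep (lam s : ℝ) (w : Galerkin N) : Galerkin N :=
  semigroup s (w + (Complex.I * lam * s) • proj N (cubic w))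

theorem continuous_detStep (lam s : ℝ) : Continuous (detStep lam s : Galerkin N → Galerkin N) := by
  refine (continuous_semigroup s).comp (continuous_id.add ?_)
  exact ((proj N).continuous.comp continuous_cubic).const_smul (Complex.I * lam * s)

theorem detStep_zero (lam : ℝ) (w : Galerkin N) : detStep lam 0 w = w := by
  simp [detStep, semigroup_zero]

/-- The forcing is itself transported by the semigroup, so the Duhamel integrand is constant in its
integration variable and the integral is `s` times `S(s)` applied to the forcing; this is why
`detStep` is explicit. -/
theorem hasDerivAt_detStep (lam s : ℝ) (w : Galerkin N) :
    HasDerivAt (fun s => detStep lam s w) (Complex.I • lap (detStep lam s w)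
      + (Complex.I * (lam : ℂ)) • semigroup s (proj N (cubic w))) s := by
  have h1 : HasDerivAt (fun s : ℝ => Complex.I * lam * (s : ℂ)) (Complex.I * lam * 1) s :=
    Complex.ofRealCLM.hasDerivAt.const_mul (Complex.I * lam)
  have h2 := (hasDerivAt_semigroup s w).add (h1.smul (hasDerivAt_semigroup s (proj N (cubic w))))
  have h3 : (fun s => detStep lam s w) = fun s => semigroup s w
      + (Complex.I * lam * (s : ℂ)) • semigroup s (proj N (cubic w)) := by
    funext s
    rw [detStep, semigroup_add, semigroup_smul]
  rw [h3]
  refine h2.congr_deriv (Eq.symm ?_)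
  rw [detStep, semigroup_add, semigroup_smul, lap_add, lap_smul, smul_add, mul_one,
    smul_comm Complex.I (Complex.I * lam * (s : ℂ)), add_assoc]

theorem inner_cubic (w : Galerkin N) :
    ⟪(w : CplxL2), cubic w⟫_ℂ = ((∫ x, ‖(w : CplxL2) x‖ ^ 4 ∂dom : ℝ) : ℂ) := by
  rw [L2.inner_def, ← integral_complex_ofReal]
  refine integral_congr_ae ?_
  filter_upwards [(cubic_memLp w).coeFn_toLp] with x hx
  change ⟪(w : CplxL2) x, ((cubic_memLp w).toLp _ : CplxL2) x⟫_ℂ = _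
  rw [hx, RCLike.inner_apply, mul_assoc, Complex.mul_conj, Complex.normSq_eq_norm_sq]
  push_cast
  ring

theorem sq_norm_cubic (w : Galerkin N) : ‖cubic w‖ ^ 2 = ∫ x, ‖(w : CplxL2) x‖ ^ 6 ∂dom := by
  have h : ((‖cubic w‖ ^ 2 : ℝ) : ℂ) = ((∫ x, ‖(w : CplxL2) x‖ ^ 6 ∂dom : ℝ) : ℂ) := by
    have h1 : ⟪cubic w, cubic w⟫_ℂ = ((‖cubic w‖ ^ 2 : ℝ) : ℂ) := by
      rw [inner_self_eq_norm_sq_to_K]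
      norm_cast
    rw [← h1, L2.inner_def, ← integral_complex_ofReal]
    refine integral_congr_ae ?_
    filter_upwards [(cubic_memLp w).coeFn_toLp] with x hx
    change ⟪((cubic_memLp w).toLp _ : CplxL2) x, ((cubic_memLp w).toLp _ : CplxL2) x⟫_ℂ = _
    rw [hx, RCLike.inner_apply, Complex.mul_conj, Complex.normSq_eq_norm_sq, norm_mul,
      Complex.norm_real, norm_pow, norm_norm]
    push_cast
    ring
  exact_mod_cast h

/-- The semigroup is isometric, and the cross term vanishes because `⟪w, P^N(|w|² w)⟫` is the real
number `∫ |w|⁴`, multiplied by an imaginary factor. Only the term quadratic in `s` remains, which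
the step bound with `L₁` can absorb. -/
theorem sq_norm_detStep_le {lam : ℝ} (hlam : |lam| = 1) (s : ℝ) (w : Galerkin N) :
    ‖detStep lam s w‖ ^ 2 ≤ ‖w‖ ^ 2 + s ^ 2 * ∫ x, ‖(w : CplxL2) x‖ ^ 6 ∂dom := by
  have h1 : ⟪w, proj N (cubic w)⟫_ℂ = ((∫ x, ‖(w : CplxL2) x‖ ^ 4 ∂dom : ℝ) : ℂ) := by
    rw [← inner_cubic]
    exact Submodule.inner_orthogonalProjectionOnto_eq_of_mem_left w (cubic w)
  have h2 : ‖proj N (cubic w)‖ ≤ ‖cubic w‖ :=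
    (GalerkinSubmodule N).norm_orthogonalProjectionOnto_apply_le (cubic w)
  rw [detStep, norm_semigroup, norm_add_sq (𝕜 := ℂ), inner_galerkin_smul, h1]
  have h3 : RCLike.re (Complex.I * lam * s * ((∫ x, ‖(w : CplxL2) x‖ ^ 4 ∂dom : ℝ) : ℂ)) = 0 := by
    simp
  have h4 : ‖Complex.I * (lam : ℂ) * (s : ℂ)‖ = |s| := by
    simp [hlam]
  rw [h3, mul_zero, add_zero, norm_smul, h4, mul_pow, sq_abs, ← sq_norm_cubic]
  gcongr

end DetStep

/-! ### The grid -/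

section Grid

variable {T : ℝ} {τ : ℕ → ℝ}

theorem grid_le (hT : 0 ≤ T) (m : ℕ) : grid T τ m ≤ T := by
  cases m with
  | zero => exact hT
  | succ m => exact min_le_right _ _

theorem grid_le_succ (hT : 0 ≤ T) (hτ : ∀ m, 0 < τ m) (m : ℕ) :
    grid T τ m ≤ grid T τ (m + 1) :=
  le_min (by linarith [hτ m]) (grid_le hT m)

theorem grid_mono (hT : 0 ≤ T) (hτ : ∀ m, 0 < τ m) : Monotone (grid T τ) :=
  monotone_nat_of_le_succ (grid_le_succ hT hτ)

theorem grid_nonneg (hT : 0 ≤ T) (hτ : ∀ m, 0 < τ m) (m : ℕ) : 0 ≤ grid T τ m :=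
  grid_mono hT hτ (Nat.zero_le m)

theorem InCell.mem_Icc {m : ℕ} {t : ℝ} (h : InCell T τ m t) :
    t ∈ Icc (grid T τ m) (grid T τ (m + 1)) := by
  refine ⟨h.1, ?_⟩
  rcases h.2 with h | ⟨h, -, h'⟩
  · exact h.le
  · rw [h, h']

theorem InCell.grid_lt (hT : 0 ≤ T) {m : ℕ} {t : ℝ} (h : InCell T τ m t) : grid T τ m < T := by
  rcases h.2 with h' | ⟨-, h', -⟩
  · exact (h.1.trans_lt h').trans_le (grid_le hT _)
  · exact h'

theorem InCell.not_lt (hT : 0 ≤ T) (hτ : ∀ m, 0 < τ m) {m n : ℕ} {t : ℝ}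
    (hm : InCell T τ m t) (hn : InCell T τ n t) : ¬ m < n := by
  intro hmn
  have h1 : grid T τ (m + 1) ≤ grid T τ n := grid_mono hT hτ hmn
  have h2 := hn.grid_lt hT
  have h3 := hn.1
  rcases hm.2 with h | ⟨-, -, h⟩ <;> linarith

theorem InCell.unique (hT : 0 ≤ T) (hτ : ∀ m, 0 < τ m) {m n : ℕ} {t : ℝ}
    (hm : InCell T τ m t) (hn : InCell T τ n t) : m = n :=
  le_antisymm (le_of_not_gt (hn.not_lt hT hτ hm)) (le_of_not_gt (hm.not_lt hT hτ hn))

/-- The cell is the one before the first grid point beyond `t` or, for `t = T`, before the first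
grid point equal to `T`. -/
theorem exists_inCell (hT : 0 < T) {n : ℕ} (hn : grid T τ n = T) {t : ℝ} (ht : t ∈ Icc 0 T) :
    ∃ m, InCell T τ m t := by
  classical
  rcases ht.2.lt_or_eq with h | h
  · have hex : ∃ m, t < grid T τ m := ⟨n, by rwa [hn]⟩
    obtain ⟨k, hk⟩ : ∃ k, Nat.find hex = k + 1 :=
      Nat.exists_eq_succ_of_ne_zero fun h0 => by
        have := Nat.find_spec hex
        rw [h0] at this
        exact absurd ht.1 (not_le.mpr this)
    refine ⟨k, not_lt.mp (Nat.find_min hex (by omega)), Or.inl ?_⟩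
    rw [← hk]
    exact Nat.find_spec hex
  · have hex : ∃ m, grid T τ m = T := ⟨n, hn⟩
    obtain ⟨k, hk⟩ : ∃ k, Nat.find hex = k + 1 :=
      Nat.exists_eq_succ_of_ne_zero fun h0 => by
        have := Nat.find_spec hex
        rw [h0] at this
        exact hT.ne this
    have hlt : grid T τ k < T :=
      lt_of_le_of_ne (grid_le hT.le k) (Nat.find_min hex (by omega))
    refine ⟨k, h ▸ hlt.le, Or.inr ⟨h, hlt, ?_⟩⟩
    rw [← hk]
    exact Nat.find_spec hex

end Grid

/-! ### The scheme -/

section Scheme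

variable {N : ℕ} {R : RealL2 →L[ℝ] RealL2} {T lam : ℝ} {τ : ℕ → ℝ} {u₀ : CplxL2}
  {ν : Control R T} {wN : ℕ → Galerkin N} {wD wS : ℕ → ℝ → Galerkin N}

/-- The difference solves the homogeneous linear equation with zero initial value, and the Laplacian
is bounded on `H_N`. -/
theorem IsScheme.wD_eq (h : IsScheme lam τ u₀ ν wN wD wS) (m : ℕ) :
    EqOn (wD m) (fun t => detStep lam (t - grid T τ m) (wN m))
      (Icc (grid T τ m) (grid T τ (m + 1))) := by
  obtain ⟨K, hK⟩ := exists_norm_lap_le N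
  have hd : ∀ t, HasDerivAt (fun t => detStep lam (t - grid T τ m) (wN m))
      (Complex.I • lap (detStep lam (t - grid T τ m) (wN m))
        + (Complex.I * (lam : ℂ)) • semigroup (t - grid T τ m) (proj N (cubic (wN m)))) t := by
    intro t
    exact (hasDerivAt_detStep lam (t - grid T τ m) (wN m)).comp_sub_const t _
  have hsub : ∀ t ∈ Icc (grid T τ m) (grid T τ (m + 1)),
      HasDerivWithinAt (fun t => wD m t - detStep lam (t - grid T τ m) (wN m))
        (Complex.I • lap (wD m t - detStep lam (t - grid T τ m) (wN m)))
        (Icc (grid T τ m) (grid T τ (m + 1))) t := by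
    intro t ht
    refine ((h.det_eq m t ht).fun_sub (hd t).hasDerivWithinAt).congr_deriv ?_
    have h1 : lap (wD m t - detStep lam (t - grid T τ m) (wN m))
        = lap (wD m t) - lap (detStep lam (t - grid T τ m) (wN m)) := by
      rw [eq_sub_iff_add_eq, ← lap_add, sub_add_cancel]
    rw [h1, smul_sub]
    abel
  intro t ht
  refine sub_eq_zero.mp (eq_zero_of_abs_deriv_le_mul_abs_self_of_eq_zero_right (K := K)
    (f' := fun t => Complex.I • lap (wD m t - detStep lam (t - grid T τ m) (wN m)))
    (fun t ht => (hsub t ht).continuousWithinAt) (fun t ht => ?_) ?_ (fun t _ => ?_) t ht)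
  · exact (hsub t ⟨ht.1, ht.2.le⟩).mono_of_mem_nhdsWithin (Icc_mem_nhdsGE_of_mem ht)
  · rw [h.det_init, sub_self, detStep_zero, sub_self]
  · rw [norm_smul, Complex.norm_I, one_mul]
    exact hK _

theorem IsScheme.isVolterraSolution (hT : 0 ≤ T) (hτ : ∀ m, 0 < τ m)
    (h : IsScheme lam τ u₀ ν wN wD wS) (m : ℕ) :
    IsVolterraSolution (controlMap N R) ν (grid T τ m) (grid T τ (m + 1))
      (detStep lam (grid T τ (m + 1) - grid T τ m) (wN m)) (wS m) := by
  refine ⟨h.con_cont m, fun t ht => ?_⟩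
  rw [h.con_eq m t ht, h.wD_eq m (right_mem_Icc.mpr (grid_le_succ hT hτ m))]
  rfl

theorem exists_isScheme (hT : 0 ≤ T) (hτ : ∀ m, 0 < τ m) (ν : Control R T) :
    ∃ (wN : ℕ → Galerkin N) (wD wS : ℕ → ℝ → Galerkin N), IsScheme lam τ u₀ ν wN wD wS := by
  have hsol : ∀ (m : ℕ) (x : Galerkin N), ∃ u, IsVolterraSolution (controlMap N R) ν
      (grid T τ m) (grid T τ (m + 1)) x u := fun m x =>
    exists_isVolterraSolution (controlMap N R) ν (grid_nonneg hT hτ m) (grid_le_succ hT hτ m)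
      (grid_le hT _) x
  choose u hu using hsol
  set step : ℕ → Galerkin N → Galerkin N := fun m w =>
    detStep lam (grid T τ (m + 1) - grid T τ m) w
  -- Solutions were chosen for every cell and every initial value, so the recursion carries only the
  -- values `w_m`. Once the grid has reached `T` the cells degenerate to a point, and the same
  -- recursion still applies.
  set wN : ℕ → Galerkin N := fun m =>
    Nat.rec (proj N u₀) (fun m w => u m (step m w) (grid T τ (m + 1))) m
  refine ⟨wN, fun m t => detStep lam (t - grid T τ m) (wN m), fun m => u m (step m (wN m)),
    ⟨rfl, fun m => ?_, fun m t _ => ?_, fun m => (hu _ _).continuousOn, fun m t ht => ?_,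
      fun m => rfl⟩⟩
  · rw [sub_self, detStep_zero]
  · exact ((hasDerivAt_detStep lam (t - grid T τ m) (wN m)).comp_sub_const t _).hasDerivWithinAt
  · exact (hu m (step m (wN m))).eq t ht

theorem IsScheme.wN_eq (hT : 0 ≤ T) (hτ : ∀ m, 0 < τ m)
    {wN' : ℕ → Galerkin N} {wD' wS' : ℕ → ℝ → Galerkin N}
    (h : IsScheme lam τ u₀ ν wN wD wS) (h' : IsScheme lam τ u₀ ν wN' wD' wS') (m : ℕ) :
    wN m = wN' m ∧ EqOn (wS m) (wS' m) (Icc (grid T τ m) (grid T τ (m + 1))) := by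
  have key : ∀ m, wN m = wN' m → EqOn (wS m) (wS' m) (Icc (grid T τ m) (grid T τ (m + 1))) := by
    intro m hm
    have h1 := h'.isVolterraSolution hT hτ m
    rw [← hm] at h1
    exact (h.isVolterraSolution hT hτ m).eqOn _ _ (grid_nonneg hT hτ m) (grid_le hT _) h1
  have hN : ∀ m, wN m = wN' m := by
    intro m
    induction m with
    | zero => rw [h.init, h'.init]
    | succ m ih =>
      rw [h.next, h'.next]
      exact key m ih (right_mem_Icc.mpr (grid_le_succ hT hτ m))
  exact ⟨hN m, key m (hN m)⟩

/-- Convergence of `w_m` passes through the continuous deterministic step to the initial values of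
the Volterra equations; uniform convergence on the cell, read at its right end point, gives
convergence of `w_{m+1}`. -/
theorem tendstoUniformlyOn_scheme (hT : 0 ≤ T) (hτ : ∀ m, 0 < τ m) {ι : Type*} {l : Filter ι}
    {ρ : ι → Control R T} {r : ℝ} (hr : ∀ i, ‖ρ i‖ ≤ r)
    (hρ : ∀ φ : StrongDual ℝ (Control R T), Tendsto (fun i => φ (ρ i)) l (𝓝 (φ ν)))
    {vN : ι → ℕ → Galerkin N} {vD vS : ι → ℕ → ℝ → Galerkin N}
    (hv : ∀ i, IsScheme lam τ u₀ (ρ i) (vN i) (vD i) (vS i))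
    (h : IsScheme lam τ u₀ ν wN wD wS) (m : ℕ) :
    TendstoUniformlyOn (fun i => vS i m) (wS m) l (Icc (grid T τ m) (grid T τ (m + 1))) := by
  have key : ∀ m, Tendsto (fun i => vN i m) l (𝓝 (wN m)) →
      TendstoUniformlyOn (fun i => vS i m) (wS m) l (Icc (grid T τ m) (grid T τ (m + 1))) := by
    intro m hm
    exact IsVolterraSolution.tendstoUniformlyOn (controlMap N R) hr hρ (grid_nonneg hT hτ m)
      (grid_le hT _) (((continuous_detStep lam _).tendsto _).comp hm)
      (fun i => (hv i).isVolterraSolution hT hτ m) (h.isVolterraSolution hT hτ m)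
  refine key m ?_
  induction m with
  | zero =>
    simp_rw [(hv _).init, h.init]
    exact tendsto_const_nhds
  | succ m ih =>
    simp_rw [(hv _).next, h.next]
    exact (key m ih).tendsto_at (right_mem_Icc.mpr (grid_le_succ hT hτ m))

/-- The bounds on the time steps along the equation without control imply that the grid
reaches `T`. -/
theorem exists_grid_eq (hT : 0 < T) (hτ : ∀ m, 0 < τ m) (hlam : |lam| = 1) {M L₁ ζ β ξ δ : ℝ}
    (hM : 0 ≤ M) (hL₁ : 0 ≤ L₁) (hζ : 0 ≤ ζ) (hβ : 0 ≤ β) (hξ : 0 < ξ) (hδ : 0 < δ)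
    (h : StepBounds N R T lam τ u₀ M L₁ ζ β ξ δ) : ∃ n, grid T τ n = T := by
  by_contra! hne
  have hlt : ∀ m, grid T τ m < T := fun m => lt_of_le_of_ne (grid_le hT.le m) (hne m)
  obtain ⟨wN, wD, wS, hw⟩ := exists_isScheme (lam := lam) (u₀ := u₀) (N := N) hT.le hτ
    (0 : Control R T)
  have h0 : (0 : Control R T) ∈ controlBall R T M := by
    change ∫ s in Icc (0 : ℝ) T, ‖(0 : Control R T) s‖ ^ 2 ≤ M
    rw [integral_sq_norm_eq, norm_zero]
    simpa using hM
  have hb := fun m => h 0 h0 wN wD wS hw m (hlt m)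
  -- For the zero control the integral vanishes by the Cauchy–Schwarz bound, so the second
  -- subequation is trivial.
  have hstep : ∀ m, wN (m + 1) = detStep lam (grid T τ (m + 1) - grid T τ m) (wN m) := by
    intro m
    have hmem := right_mem_Icc.mpr (grid_le_succ hT.le hτ m)
    have h1 := hw.isVolterraSolution hT.le hτ m
    have h2 := sq_norm_integral_bilin_le (controlMap N R) (0 : Control R T)
      (grid_nonneg hT.le hτ m) (grid_le_succ hT.le hτ m) (grid_le hT.le _) h1.continuousOn
    rw [norm_zero, mul_zero, zero_pow two_ne_zero, zero_mul] at h2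
    rw [hw.next, h1.eq _ hmem, norm_eq_zero.mp
      (pow_eq_zero_iff two_ne_zero |>.mp (le_antisymm h2 (sq_nonneg _))), add_zero]
  have hsucc : ∀ m, grid T τ (m + 1) = grid T τ m + τ m := by
    intro m
    have h1 := hlt (m + 1)
    change min _ _ < _ at h1
    change min _ _ = _
    rcases min_lt_iff.mp h1 with h2 | h2
    · exact min_eq_left h2.le
    · exact absurd h2 (lt_irrefl _)
  -- Discrete Grönwall: the step bound turns the growth `τ² ∫ |w|⁶` into `L₁ τ ‖w‖²`, and `1 + L₁ τ
  -- ≤ exp (L₁ τ)`.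
  have hnorm : ∀ m, ‖wN m‖ ^ 2 ≤ Real.exp (L₁ * grid T τ m) * ‖wN 0‖ ^ 2 := by
    intro m
    induction m with
    | zero => simp [grid]
    | succ m ih =>
      have h1 := sq_norm_detStep_le hlam (grid T τ (m + 1) - grid T τ m) (wN m)
      rw [← hstep m] at h1
      have h2 := (hb m).1
      have h3 : L₁ * τ m + 1 ≤ Real.exp (L₁ * τ m) := Real.add_one_le_exp _
      rw [hsucc m, add_sub_cancel_left] at h1
      rw [hsucc m, mul_add, add_comm (L₁ * _), Real.exp_add, mul_assoc]
      calc ‖wN (m + 1)‖ ^ 2 ≤ (L₁ * τ m + 1) * ‖wN m‖ ^ 2 := by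
            nlinarith [mul_le_mul_of_nonneg_left h2 (hτ m).le]
        _ ≤ _ := mul_le_mul h3 ih (sq_nonneg _) (Real.exp_pos _).le
  set C : ℝ := √(Real.exp (L₁ * T) * ‖wN 0‖ ^ 2)
  have hC : ∀ m, ‖wN m‖ ≤ C := fun m => Real.le_sqrt_of_sq_le ((hnorm m).trans (by
    have := (hlt m).le
    gcongr))
  -- The lower step bound at the largest possible norm `C`; steps of length at least `c` would
  -- exceed `T` after finitely many.
  set c : ℝ := (ζ * C ^ β + ξ)⁻¹ * δ
  have hc : 0 < c := by positivity
  have hτc : ∀ m, c ≤ τ m := by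
    intro m
    refine le_trans ?_ (hb m).2.2
    have := hC m
    change (ζ * C ^ β + ξ)⁻¹ * δ ≤ _
    gcongr
  have hlow : ∀ m : ℕ, m * c ≤ grid T τ m := by
    intro m
    induction m with
    | zero => simp [grid]
    | succ m ih =>
      rw [hsucc m]
      push_cast
      linarith [hτc m]
  obtain ⟨n, hn⟩ := exists_nat_gt (T / c)
  have h1 : T < n * c := (div_lt_iff₀ hc).mp hn
  linarith [hlow n, hlt n]

end Scheme

/-! ### The space of controls -/

/-- The pseudo-inverse is an isometry onto the complete space `(ker R)ᗮ`. Completeness makes the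
space of controls a Hilbert space, as Riesz requires. -/
instance (R : RealL2 →L[ℝ] RealL2) : CompleteSpace (CamSpace R) := by
  have h : Isometry (CamSpace.pinv R) :=
    AddMonoidHomClass.isometry_of_norm (CamSpace.pinv R) fun _ => rfl
  exact (h.isUniformInducing.completeSpace_congr (CamSpace.pinv R).surjective).mpr inferInstance

theorem mem_controlBall_iff {R : RealL2 →L[ℝ] RealL2} {T M : ℝ} (hM : 0 ≤ M) {ν : Control R T} :
    ν ∈ controlBall R T M ↔ ‖ν‖ ≤ √M := by
  rw [Real.le_sqrt (norm_nonneg _) hM, ← integral_sq_norm_eq]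
  rfl

theorem CamSpace.incl_injective (R : RealL2 →L[ℝ] RealL2) :
    Function.Injective (CamSpace.incl R) := Subtype.val_injective

/-- Lebesgue differentiation recovers the control almost everywhere from its primitive. -/
theorem primitive_injective {R : RealL2 →L[ℝ] RealL2} {T : ℝ} (hT : 0 ≤ T) :
    Function.Injective (primitive : Control R T → C(Icc (0 : ℝ) T, RealL2)) := by
  intro ν ρ h
  have hii : ∀ σ : Control R T,
      IntervalIntegrable (fun s => CamSpace.incl R (σ s)) volume 0 T := fun σ => by
    rw [intervalIntegrable_iff_integrableOn_Icc_of_le hT]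
    exact control_integrable σ
  refine Lp.ext ?_
  rw [Filter.EventuallyEq, ae_restrict_iff' measurableSet_Icc]
  -- The end points are discarded because the primitives are known to agree only on `[0,T]`, and
  -- differentiation needs a full neighbourhood.
  have h0 : ∀ᵐ t : ℝ, t ≠ 0 := by simp [ae_iff, measure_singleton]
  have h1 : ∀ᵐ t : ℝ, t ≠ T := by simp [ae_iff, measure_singleton]
  filter_upwards [(hii ν).ae_hasDerivAt_integral, (hii ρ).ae_hasDerivAt_integral, h0, h1]
    with t hν hρ ht0 htT ht
  have htm : t ∈ uIcc 0 T := by rwa [uIcc_of_le hT]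
  have h2 := hν htm 0 left_mem_uIcc
  have h3 := hρ htm 0 left_mem_uIcc
  have heq : (fun t => ∫ s in (0 : ℝ)..t, CamSpace.incl R (ν s))
      =ᶠ[𝓝 t] fun t => ∫ s in (0 : ℝ)..t, CamSpace.incl R (ρ s) := by
    filter_upwards [Icc_mem_nhds (lt_of_le_of_ne ht.1 ht0.symm) (lt_of_le_of_ne ht.2 htT)]
      with s hs
    exact DFunLike.congr_fun h ⟨s, hs⟩
  exact CamSpace.incl_injective R (h2.unique (h3.congr_of_eventuallyEq heq))

/-- The image of a ball of a Hilbert space under a map which is continuous for the weak topology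
of the ball is compact. -/
theorem isCompact_image_of_tendsto_of_weak.{u, v} {H : Type u} [NormedAddCommGroup H]
    [InnerProductSpace ℝ H] [CompleteSpace H] {Y : Type v} [TopologicalSpace Y] {Φ : H → Y} {r : ℝ}
    (hΦ : ∀ (ι : Type u) (l : Filter ι) (x : ι → H) (x₀ : H), (∀ i, ‖x i‖ ≤ r) →
      (∀ φ : StrongDual ℝ H, Tendsto (fun i => φ (x i)) l (𝓝 (φ x₀))) →
      Tendsto (fun i => Φ (x i)) l (𝓝 (Φ x₀))) : IsCompact (Φ '' {x | ‖x‖ ≤ r}) := by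
  -- The ball is moved to the dual by Riesz, where Banach–Alaoglu gives weak-star compactness.
  set S : Set (WeakDual ℝ H) := WeakDual.toStrongDual ⁻¹' Metric.closedBall 0 r
  set e : WeakDual ℝ H → H := fun x =>
    (InnerProductSpace.toDual ℝ H).symm (WeakDual.toStrongDual x)
  have hS : IsCompact S := WeakDual.isCompact_closedBall 0 r
  have hmem : ∀ x, x ∈ S ↔ ‖WeakDual.toStrongDual x‖ ≤ r := fun x => by
    rw [mem_preimage, Metric.mem_closedBall, dist_zero_right]
  have he : ∀ x ∈ S, ‖e x‖ ≤ r := fun x hx => by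
    rw [LinearIsometryEquiv.norm_map]
    exact (hmem x).mp hx
  have himage : Φ '' {x | ‖x‖ ≤ r} = (fun x => Φ (e x)) '' S := by
    refine Subset.antisymm ?_ ?_
    · rintro - ⟨x, hx, rfl⟩
      refine ⟨StrongDual.toWeakDual (InnerProductSpace.toDual ℝ H x), ?_, ?_⟩
      · exact (hmem _).mpr (((InnerProductSpace.toDual ℝ H).norm_map x).trans_le hx)
      · exact congrArg Φ ((InnerProductSpace.toDual ℝ H).symm_apply_apply x)
    · rintro - ⟨x, hx, rfl⟩
      exact ⟨e x, he x hx, rfl⟩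
  rw [himage]
  refine hS.image_of_continuousOn ?_
  rw [continuousOn_iff_continuous_domRestrict, continuous_iff_continuousAt]
  intro x
  -- The compact set itself serves as index type, with its neighbourhood filters in place of
  -- sequences.
  refine hΦ S (𝓝 x) (fun y => e y) (e x) (fun y => he y y.2) fun φ => ?_
  obtain ⟨h, rfl⟩ := (InnerProductSpace.toDual ℝ H).surjective φ
  have heval : ∀ y : S, InnerProductSpace.toDual ℝ H h (e y) = (y : WeakDual ℝ H) h := by
    intro y
    rw [InnerProductSpace.toDual_apply_apply, real_inner_comm,
      InnerProductSpace.toDual_symm_apply]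
    rfl
  simp_rw [heval]
  exact ((WeakDual.eval_continuous h).comp continuous_subtype_val).tendsto x

/-! ### The skeleton map -/

section Skeleton

variable {N : ℕ} {R : RealL2 →L[ℝ] RealL2} {T lam : ℝ} {τ : ℕ → ℝ} {u₀ : CplxL2}

open Classical in
theorem exists_isSkeletonSolution (hT : 0 ≤ T) (hτ : ∀ m, 0 < τ m) (ν : Control R T) :
    ∃ w : Icc (0 : ℝ) T →ᵤ Galerkin N, IsSkeletonSolution lam τ u₀ ν w := by
  obtain ⟨wN, wD, wS, h⟩ := exists_isScheme (N := N) (lam := lam) (u₀ := u₀) hT hτ ν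
  refine ⟨UniformFun.ofFun fun t => if h : ∃ m, InCell T τ m t then wS h.choose t else 0,
    wN, wD, wS, h, fun m t ht => ?_⟩
  have hex : ∃ m, InCell T τ m t := ⟨m, ht⟩
  rw [UniformFun.toFun_ofFun, dif_pos hex, hex.choose_spec.unique hT hτ ht]

theorem IsSkeletonSolution.unique (hT : 0 < T) (hτ : ∀ m, 0 < τ m) {n : ℕ}
    (hn : grid T τ n = T) {ν : Control R T} {w w' : Icc (0 : ℝ) T →ᵤ Galerkin N}
    (h : IsSkeletonSolution lam τ u₀ ν w) (h' : IsSkeletonSolution lam τ u₀ ν w') : w = w' := by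
  obtain ⟨wN, wD, wS, hw, hwS⟩ := h
  obtain ⟨wN', wD', wS', hw', hwS'⟩ := h'
  refine UniformFun.toFun.injective (funext fun t => ?_)
  obtain ⟨m, hm⟩ := exists_inCell hT hn t.2
  rw [hwS m t hm, hwS' m t hm]
  exact (hw.wN_eq hT.le hτ hw' m).2 hm.mem_Icc

/-- The choice in the definition could involve a different control with the same primitive;
injectivity of the primitive excludes this. -/
theorem isSkeletonSolution_skeletonMap (hT : 0 ≤ T) (hτ : ∀ m, 0 < τ m) (ν : Control R T) :
    IsSkeletonSolution lam τ u₀ ν (skeletonMap N R T lam τ u₀ (primitive ν)) := by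
  have hex : ∃ (w : Icc (0 : ℝ) T →ᵤ Galerkin N) (ρ : Control R T),
      primitive ρ = primitive ν ∧ IsSkeletonSolution lam τ u₀ ρ w := by
    obtain ⟨w, hw⟩ := exists_isSkeletonSolution (N := N) (lam := lam) (u₀ := u₀) hT hτ ν
    exact ⟨w, ν, rfl, hw⟩
  rw [skeletonMap, dif_pos hex]
  obtain ⟨ρ, hρ, h⟩ := hex.choose_spec
  rwa [primitive_injective hT hρ] at h

theorem IsSkeletonSolution.mem_piecewiseCont {ν : Control R T}
    {w : Icc (0 : ℝ) T →ᵤ Galerkin N} (h : IsSkeletonSolution lam τ u₀ ν w) :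
    w ∈ piecewiseCont N T τ := by
  obtain ⟨wN, wD, wS, hw, hwS⟩ := h
  exact fun m _ => ⟨wS m, hw.con_cont m, hwS m⟩

/-- The first `n` cells already cover `[0,T]`, so the uniform estimates on the individual cells hold
simultaneously along the filter. -/
theorem IsSkeletonSolution.tendsto (hT : 0 < T) (hτ : ∀ m, 0 < τ m) {n : ℕ}
    (hn : grid T τ n = T) {ι : Type*} {l : Filter ι} {ρ : ι → Control R T} {ν : Control R T}
    {r : ℝ} (hr : ∀ i, ‖ρ i‖ ≤ r)
    (hρ : ∀ φ : StrongDual ℝ (Control R T), Tendsto (fun i => φ (ρ i)) l (𝓝 (φ ν)))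
    {v : ι → Icc (0 : ℝ) T →ᵤ Galerkin N} {w : Icc (0 : ℝ) T →ᵤ Galerkin N}
    (hv : ∀ i, IsSkeletonSolution lam τ u₀ (ρ i) (v i)) (hw : IsSkeletonSolution lam τ u₀ ν w) :
    Tendsto v l (𝓝 w) := by
  choose vN vD vS hvs hvS using hv
  obtain ⟨wN, wD, wS, hws, hwS⟩ := hw
  rw [UniformFun.tendsto_iff_tendstoUniformly, Metric.tendstoUniformly_iff]
  intro ε hε
  have h := (Filter.eventually_all_finset (Finset.range n)).mpr fun m _ =>
    Metric.tendstoUniformlyOn_iff.mp (tendstoUniformlyOn_scheme hT.le hτ hr hρ hvs hws m) ε hε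
  filter_upwards [h] with i hi t
  obtain ⟨m, hm⟩ := exists_inCell hT hn t.2
  have hmn : m < n := by
    by_contra hnm
    have h1 := grid_mono hT.le hτ (le_of_not_gt hnm)
    have h2 := hm.grid_lt hT.le
    linarith
  rw [Function.comp_apply, hwS m t hm, hvS i m t hm]
  exact hi m (Finset.mem_range.mpr hmn) t hm.mem_Icc

theorem isCompact_skeletonSet (hT : 0 < T) (hτ : ∀ m, 0 < τ m) {n : ℕ} (hn : grid T τ n = T)
    {M : ℝ} (hM : 0 ≤ M) : IsCompact (skeletonSet N R T lam τ u₀ M) := by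
  have himage : skeletonSet N R T lam τ u₀ M
      = (fun ν => skeletonMap N R T lam τ u₀ (primitive ν)) '' {ν : Control R T | ‖ν‖ ≤ √M} := by
    rw [skeletonSet]
    exact congrArg _ (Set.ext fun ν => mem_controlBall_iff hM)
  rw [himage]
  exact isCompact_image_of_tendsto_of_weak fun ι l ρ ν hr hρ =>
    IsSkeletonSolution.tendsto hT hτ hn hr hρ
      (fun i => isSkeletonSolution_skeletonMap hT.le hτ (ρ i))
      (isSkeletonSolution_skeletonMap hT.le hτ ν)

end Skeleton

end SkeletonNLS

/-! ### The main theorem -/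

theorem mainTheorem9
    (N : ℕ) (hN : 1 ≤ N) (T : ℝ) (hT : 0 < T) (lam : ℝ) (hlam : lam = 1 ∨ lam = -1)
    (R : SkeletonNLS.RealL2 →L[ℝ] SkeletonNLS.RealL2) (hR : R.IsPositive)
    (u₀ : SkeletonNLS.CplxL2) (M : ℝ) (hM : 0 < M)
    (τ : ℕ → ℝ) (hτ : ∀ m, 0 < τ m)
    (L₁ ζ β ξ δ : ℝ) (hL₁ : 0 < L₁) (hζ : 0 < ζ) (hβ : 0 < β) (hξ : 0 < ξ)
    (hδ : 0 < δ) (hδ' : δ < 1)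
    (h₃ : SkeletonNLS.StepBounds N R T lam τ u₀ M L₁ ζ β ξ δ)
    (γ L₂ L₃ : ℝ) (hγ : 0 < γ) (hγ' : γ < 1 / 2) (hL₂ : 0 < L₂) (hL₃ : 0 < L₃)
    (h₄ : SkeletonNLS.StepBoundsEnergy N R T lam τ u₀ M γ L₂ L₃) :
    (∀ ν ∈ SkeletonNLS.controlBall R T M, ∀ w : Icc (0 : ℝ) T →ᵤ SkeletonNLS.Galerkin N,
      SkeletonNLS.IsSkeletonSolution lam τ u₀ ν w ↔
        w = SkeletonNLS.skeletonMap N R T lam τ u₀ (SkeletonNLS.primitive ν)) ∧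
    SkeletonNLS.skeletonSet N R T lam τ u₀ M ⊆ SkeletonNLS.piecewiseCont N T τ ∧
    IsCompact (SkeletonNLS.skeletonSet N R T lam τ u₀ M) := by
  have hlam' : |lam| = 1 := by rcases hlam with rfl | rfl <;> simp
  obtain ⟨n, hn⟩ := SkeletonNLS.exists_grid_eq hT hτ hlam' hM.le hL₁.le hζ.le hβ.le hξ hδ h₃
  refine ⟨fun ν _ w => ⟨fun h => ?_, ?_⟩, ?_, SkeletonNLS.isCompact_skeletonSet hT hτ hn hM.le⟩
  · exact h.unique hT hτ hn (SkeletonNLS.isSkeletonSolution_skeletonMap hT.le hτ ν)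
  · rintro rfl
    exact SkeletonNLS.isSkeletonSolution_skeletonMap hT.le hτ ν
  · rintro - ⟨ν, -, rfl⟩
    exact (SkeletonNLS.isSkeletonSolution_skeletonMap hT.le hτ ν).mem_piecewiseCont
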